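/- Let $\Bbbk$ be an algebraically closed field of characteristic $0$, let $m,n\ge 0$, and let $q\in\Bbbk^\times$ with $q\neq\pm1$. Let $\mathbf{char}(q)$ be the least positive integer $\ell$ with $[\ell]=\frac{q^\ell-q^{-\ell}}{q-q^{-1}}=0$, and $0$ if there is none. *The superalgebras.* $\Lambda_q(m)$ is the algebra with generators $x_1,\dots,x_m$ and relations $x_i^2=0$, $x_jx_i=-q^{-1}x_ix_j$ for $i<j$; $\Lambda_q(m)^{(i)}$ is the span of the products of $i$ generators with increasing indices. $\mathcal A_{q^{-1}}(n)$ is the quantum divided power algebra, with basis $x^{(\alpha)}$, $\alpha\in\mathbb Z_+^n$, and product $x^{(\alpha)}x^{(\beta)}=q^{-\alpha*\beta}\prod_i\begin{bmatrix}\alpha_i+\beta_i\\ \alpha_i\end{bmatrix}x^{(\alpha+\beta)}$, where $\alpha*\beta=\sum_{i>j}\alpha_i\beta_j$; $\mathcal A_{q^{-1}}^{(s)}(n)$ is the span of the $x^{(\alpha)}$ with $|\alpha|=\sum_i\alpha_i=s$. If $\mathbf{char}(q)=\ell\ge3$, $\mathcal A_{q^{-1}}^{(s)}(n;\mathbf 1)$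 is the span of those with moreover $\alpha_i\le\ell-1$ for all $i$. The quantum dual Grassmann superalgebra is $\Omega_q^!(m|n)=\Lambda_q(m)\otimes\mathcal A_{q^{-1}}(n)$ with $(x^\mu\otimes x^{(\alpha)})(x^\nu\otimes x^{(\beta)})=(-q)^{-|\alpha||\nu|}x^\mu x^\nu\otimes x^{(\alpha)}x^{(\beta)}$, with components $\Omega_q^!(m|n)^{(t)}=\bigoplus_{i+j=t}\Lambda_q(m)^{(i)}\otimes\mathcal A_{q^{-1}}^{(j)}(n)$; the components $\Omega_q^!(m|n,\mathbf 1)^{(t)}$ of the restricted one are defined in the same way from $\mathcal A_{q^{-1}}^{(j)}(n;\mathbf 1)$. *The modules.* $\mathcal U_q$ is the bosonization $\mathcal U_q(\mathfrak{gl}(m|n))=U_q(\mathfrak{gl}(m|n))\#\Bbbk[\mathbb Z_2]$, generated by $E_j,F_j$ ($1\le j<m+n$), $K_i^{\pm1}$ ($1\le i\le m+n$) and the parity element $\sigma$, or its subalgebra $\mathcal U_q(\mathfrak{sl}(m|n))$ generated by the $E_j,F_j,\sigma$ and $\mathcal K_j^{\pm1}=(K_jK_{j+1}^{-1})^{\pm1}$.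 If $\mathbf{char}(q)=\ell\ge 3$, $u_q$ is the quotient of $\mathcal U_q$ by the relations $E_j^\ell=F_j^\ell=0$ ($j\ne m$), $E_m^2=F_m^2=0$ and $K_i^{2\ell}=1$ (in the case of $\mathfrak{sl}$: $\mathcal K_j^{2\ell}=1$). For $\lambda=\sum_i\lambda_i\epsilon_i$ with $\lambda_i\in\mathbb Z$, $V(\lambda)$ is the simple highest weight module of highest weight $\lambda$ over $\mathcal U_q$ (over $u_q$ in the restricted case): the quotient of the universal module $M$ generated by a vector $v$ with $E_jv=0$, $K_iv=q_i^{\lambda_i}v$ (for $\mathfrak{sl}$: $\mathcal K_jv=q_j^{\lambda_j}q_{j+1}^{-\lambda_{j+1}}v$), $\sigma v=(-1)^{\lambda_{m+1}+\dots+\lambda_{m+n}}v$, by the largest submodule contained in $\sum_jF_jM$; here $q_i=q$ for $i\le m$ and $q_i=q^{-1}$ for $i>m$. Put $\omega_t=\epsilon_1+\dots+\epsilon_t$. Let $t\ge0$. (i) Suppose $\mathbf{char}(q)=0$. If $t\le m$, then $V(\omega_t)$ is simple and $$\dim\Omega_q^!(m|n)^{(t)}=\dim V(\omega_t)=\sum_{0\le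 s\le t}\binom ms\binom{n+t-s-1}{t-s}.$$ If $t>m$, then $$\dim\Omega_q^!(m|n)^{(t)}=\sum_{0\le s\le m}\binom ms\binom{n+t-s-1}{t-s},$$ and, if $n\ge1$, $V(\omega_m+(t-m)\epsilon_{m+1})$ is simple and has the same dimension. (Here $\binom{-1}{0}=1$.) (ii) Suppose $\mathbf{char}(q)=\ell\ge3$. If $t\le m$, then $V(\omega_t)$ is simple and $$\dim\Omega_q^!(m|n,\mathbf 1)^{(t)}=\dim V(\omega_t)=\sum_{0\le s\le t}\binom ms\dim\mathcal A_{q^{-1}}^{(t-s)}(n;\mathbf 1).$$ If $t>m$, then $$\dim\Omega_q^!(m|n,\mathbf 1)^{(t)}=\sum_{0\le s\le m}\binom ms\dim\mathcal A_{q^{-1}}^{(t-s)}(n;\mathbf 1),$$ and whenever $t-m=(i-1)(\ell-1)+r$ with $1\le i\le n$ and $0\le r\le\ell-1$, the module $V\bigl(\omega_m+(\ell-1)\epsilon_{m+1}+\dots+(\ell-1)\epsilon_{m+i-1}+r\epsilon_{m+i}\bigr)$ is simple and has the same dimension. Moreover every $\mathcal A_{q^{-1}}^{(s)}(n;\mathbf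 1)$, $s\ge0$, is finite-dimensional, and for $n\ge1$ $$\dim\mathcal A_{q^{-1}}^{(s)}(n;\mathbf 1)=\sum_{i=0}^{\lfloor s/\ell\rfloor}(-1)^i\binom ni\binom{n+s-i\ell-1}{n-1}.$$ -/

import Mathlib

open scoped TensorProduct

noncomputable section

namespace QuantumGrassmann

universe u

variable {k : Type u} [Field k]

/-! ### Quantum integers, quantum binomials, the characteristic of `q` -/

/-- The value at `v = q` of the Laurent polynomial
`[a]_v = (v^a - v^(-a)) / (v - v^(-1)) = ∑_{i < a} v^(a - 1 - 2 i)`. -/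
def qInt (q : k) (a : ℕ) : k := ∑ i ∈ Finset.range a, q ^ ((a : ℤ) - 1 - 2 * (i : ℤ))

/-- The characteristic of `q`: the least positive `ℓ` with `[ℓ] = 0`, and `0` if there is none. -/
def qChar (q : k) : ℕ := sInf {ℓ : ℕ | 0 < ℓ ∧ qInt q ℓ = 0}

/-- The value at `v = q` of the Gaussian binomial coefficient (symmetric normalization), through
the recursion `[a; r] = q^(r-a) [a-1; r-1] + q^r [a-1; r]`. -/
def qBinom (q : k) : ℕ → ℕ → k
  | _, 0 => 1
  | 0, _ + 1 => 0
  | a + 1, r + 1 => q ^ ((r : ℤ) - (a : ℤ)) * qBinom q a r + q ^ (r + 1) * qBinom q a (r + 1)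

/-! ### The quantum divided power algebra `𝒜_q(n)` -/

/-- `β ∗ γ = ∑_{i > j} β_i γ_j`. -/
def starProd {n : ℕ} (β γ : Fin n → ℕ) : ℕ :=
  ∑ i : Fin n, ∑ j : Fin n, if j < i then β i * γ j else 0

/-- The quantum divided power algebra `𝒜_q(n)`: the vector space with monomial basis `x^(β)`,
`β ∈ ℕ^n`. Its product is `DivPow.mul`. -/
abbrev DivPow (_q : k) (n : ℕ) : Type u := (Fin n → ℕ) →₀ k

/-- The basis monomial `x^(β)`. -/
def DivPow.mono (q : k) {n : ℕ} (β : Fin n → ℕ) : DivPow q n := Finsupp.single β 1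

/-- The product `x^(β) x^(γ) = q^(β ∗ γ) [β + γ; β] x^(β + γ)` of `𝒜_q(n)`. -/
def DivPow.mul (q : k) (n : ℕ) : DivPow q n →ₗ[k] DivPow q n →ₗ[k] DivPow q n :=
  Finsupp.lift _ k _ fun β => Finsupp.lift _ k _ fun γ =>
    (q ^ starProd β γ * ∏ i, qBinom q (β i + γ i) (β i)) • DivPow.mono q (β + γ)

/-- The homogeneous component `𝒜_q(n)^(s)`. -/
def DivPow.deg (q : k) (n s : ℕ) : Submodule k (DivPow q n) :=
  Submodule.span k {x | ∃ β : Fin n → ℕ, ∑ i, β i = s ∧ x = DivPow.mono q β}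

/-- The homogeneous component `𝒜_q(n; 1)^(s)` of the restricted algebra, which is spanned by the
monomials `x^(β)` with `β ≤ (ℓ - 1, …, ℓ - 1)`, where `ℓ = char(q)`. -/
def DivPow.restrictedDeg (q : k) (n s : ℕ) : Submodule k (DivPow q n) :=
  Submodule.span k {x | ∃ β : Fin n → ℕ,
    (∀ i, β i ≤ qChar q - 1) ∧ ∑ i, β i = s ∧ x = DivPow.mono q β}

/-! ### The quantum exterior algebra `Λ_q(m)` -/

/-- The defining relations `x_i^2 = 0` and `x_j x_i = - q^(-1) x_i x_j` for `i < j`. -/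
inductive ExtRel (q : k) (m : ℕ) : FreeAlgebra k (Fin m) → FreeAlgebra k (Fin m) → Prop
  | sq (i : Fin m) : ExtRel q m (FreeAlgebra.ι k i * FreeAlgebra.ι k i) 0
  | anti (i j : Fin m) (h : i < j) :
      ExtRel q m (FreeAlgebra.ι k j * FreeAlgebra.ι k i)
        ((-q⁻¹) • (FreeAlgebra.ι k i * FreeAlgebra.ι k j))

/-- The quantum exterior algebra `Λ_q(m)`. -/
abbrev QExt (q : k) (m : ℕ) : Type u := RingQuot (ExtRel q m)

/-- The generator `x_i` of `Λ_q(m)`. -/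
def QExt.gen (q : k) {m : ℕ} (i : Fin m) : QExt q m :=
  RingQuot.mkAlgHom k (ExtRel q m) (FreeAlgebra.ι k i)

/-- The monomial `x^μ = x_{i_1} ⋯ x_{i_s}` for `μ = {i_1 < ⋯ < i_s}`. -/
def QExt.mono (q : k) {m : ℕ} (μ : Finset (Fin m)) : QExt q m :=
  ((μ.sort (· ≤ ·)).map (QExt.gen q)).prod

/-- The homogeneous component `Λ_q(m)^(i)`. -/
def QExt.deg (q : k) (m i : ℕ) : Submodule k (QExt q m) :=
  Submodule.span k {x | ∃ μ : Finset (Fin m), μ.card = i ∧ x = QExt.mono q μ}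

/-- The algebra endomorphism `x_i ↦ c x_i` of `Λ_q(m)`; it multiplies `x^ν` by `c^|ν|`. -/
def QExt.scale (q : k) (m : ℕ) (c : k) : QExt q m →ₐ[k] QExt q m :=
  RingQuot.liftAlgHom k ⟨FreeAlgebra.lift k fun i => c • QExt.gen q i, by
    intro x y h
    cases h with
    | sq i =>
      have h1 : QExt.gen q i * QExt.gen q i = 0 := by
        simpa [QExt.gen] using RingQuot.mkAlgHom_rel k (ExtRel.sq (q := q) i)
      simp [h1]
    | anti i j h =>
      have h1 : QExt.gen q j * QExt.gen q i = (-q⁻¹) • (QExt.gen q i * QExt.gen q j) := by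
        simpa only [QExt.gen, map_mul, map_smul] using
          RingQuot.mkAlgHom_rel k (ExtRel.anti (q := q) i j h)
      simp only [map_mul, map_smul, FreeAlgebra.lift_ι_apply, smul_mul_smul_comm, h1]
      rw [smul_comm]⟩

/-! ### The quantum dual Grassmann superalgebra `Ω_q^!(m|n)` -/

/-- `Ω_q^!(m|n) = Λ_q(m) ⊗ 𝒜_{q⁻¹}(n)`. Its product is `Omega.mul`. -/
abbrev Omega (q : k) (m n : ℕ) : Type u := QExt q m ⊗[k] DivPow q⁻¹ n

/-- The product
`(x^μ ⊗ x^(α)) (x^ν ⊗ x^(β)) = (-q)^(-(α ∗ ν)) x^μ x^ν ⊗ x^(α) x^(β)`, where `α ∗ ν = |α| |ν|`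
because every index of `α` comes after every index of `ν`. -/
def Omega.mul (q : k) (m n : ℕ) : Omega q m n →ₗ[k] Omega q m n →ₗ[k] Omega q m n :=
  TensorProduct.lift <| LinearMap.flip <| Finsupp.lift _ k _ fun α =>
    ((TensorProduct.mapBilinear (RingHom.id k) (QExt q m) (DivPow q⁻¹ n)
      (QExt q m) (DivPow q⁻¹ n)).flip (DivPow.mul q⁻¹ n (DivPow.mono q⁻¹ α))) ∘ₗ
      (LinearMap.mul k (QExt q m)).compl₂
        (QExt.scale q m ((-q)⁻¹ ^ ∑ i, α i)).toLinearMap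

/-- The homogeneous component
`Ω_q^!(m|n)^(t) = ⨁_{i + j = t} Λ_q(m)^(i) ⊗ 𝒜_{q⁻¹}(n)^(j)`, as a subspace of `Ω_q^!(m|n)`. -/
def Omega.deg (q : k) (m n t : ℕ) : Submodule k (Omega q m n) :=
  ⨆ p ∈ Finset.HasAntidiagonal.antidiagonal t,
    Submodule.map₂ (TensorProduct.mk k (QExt q m) (DivPow q⁻¹ n))
      (QExt.deg q m p.1) (DivPow.deg q⁻¹ n p.2)

/-- The homogeneous component
`Ω_q^!(m|n, 1)^(t) = ⨁_{i + j = t} Λ_q(m)^(i) ⊗ 𝒜_{q⁻¹}(n; 1)^(j)` of the quantum restricted dual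
Grassmann superalgebra `Ω_q^!(m|n, 1) = Λ_q(m) ⊗ 𝒜_{q⁻¹}(n; 1)`. -/
def Omega.restrictedDeg (q : k) (m n t : ℕ) : Submodule k (Omega q m n) :=
  ⨆ p ∈ Finset.HasAntidiagonal.antidiagonal t,
    Submodule.map₂ (TensorProduct.mk k (QExt q m) (DivPow q⁻¹ n))
      (QExt.deg q m p.1) (DivPow.restrictedDeg q⁻¹ n p.2)

/-! ### The quantum general linear superalgebra, bosonized -/

/-- Generators of `𝒰_q(gl(m|n))`. Indices start at `0`: the index set `{1, …, m + n}` is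
`Fin (m + n)` and `{1, …, m + n - 1}` is `Fin (m + n - 1)`; so the odd `E`, `F` are those with
`j + 1 = m`. -/
inductive Gen (m n : ℕ) : Type
  | E (j : Fin (m + n - 1))
  | F (j : Fin (m + n - 1))
  | K (i : Fin (m + n))
  | Kinv (i : Fin (m + n))
  | sigma

/-- The index `j` of `{1, …, m + n - 1}`, seen in `{1, …, m + n}`. -/
def lo {m n : ℕ} (j : Fin (m + n - 1)) : Fin (m + n) := ⟨j.1, by omega⟩

/-- The index `j + 1` for `j` in `{1, …, m + n - 1}`. -/
def hi {m n : ℕ} (j : Fin (m + n - 1)) : Fin (m + n) := ⟨j.1 + 1, by omega⟩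

/-- `q_i = q` for `i` among the first `m` indices, `q_i = q⁻¹` for the last `n`. -/
def qi (q : k) (m : ℕ) (i : ℕ) : k := if i < m then q else q⁻¹

/-- The parity `p(E_j) = p(F_j) = δ_{jm}`. -/
def par (m : ℕ) (j : ℕ) : ℕ := if j + 1 = m then 1 else 0

section Relations

variable (k) (m n : ℕ)

/-- The free algebra on the generators. -/
abbrev FreeU : Type u := FreeAlgebra k (Gen m n)

variable {m n}

/-- `E_j` in the free algebra. -/
def fE (j : Fin (m + n - 1)) : FreeU k m n := FreeAlgebra.ι k (Gen.E j)
/-- `F_j` in the free algebra. -/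
def fF (j : Fin (m + n - 1)) : FreeU k m n := FreeAlgebra.ι k (Gen.F j)
/-- `K_i` in the free algebra. -/
def fK (i : Fin (m + n)) : FreeU k m n := FreeAlgebra.ι k (Gen.K i)
/-- `K_i⁻¹` in the free algebra. -/
def fKinv (i : Fin (m + n)) : FreeU k m n := FreeAlgebra.ι k (Gen.Kinv i)
/-- The parity element `σ` in the free algebra. -/
def fS : FreeU k m n := FreeAlgebra.ι k Gen.sigma

end Relations

/-- The left-hand side of the quadratic-cubic Serre relation:
`a^2 b - (q + q⁻¹) a b a + b a^2`. -/
def serre3 {A : Type u} [Ring A] [Algebra k A] (q : k) (a b : A) : A :=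
  a * a * b - (q + q⁻¹) • (a * b * a) + b * a * a

/-- The left-hand side of the extra Serre relation around the odd generator `b`:
`a b c b + b a b c + c b a b + b c b a - (q + q⁻¹) b a c b`. -/
def serre4 {A : Type u} [Ring A] [Algebra k A] (q : k) (a b c : A) : A :=
  a * b * c * b + b * a * b * c + c * b * a * b + b * c * b * a - (q + q⁻¹) • (b * a * c * b)

/-- The defining relations of `𝒰_q(gl(m|n)) = U_q(gl(m|n)) # k[ℤ/2]`: those of `U_q(gl(m|n))`,
and those saying that `σ` has order two and that conjugation by it is the parity automorphism. -/
inductive URel (q : k) (m n : ℕ) : FreeU k m n → FreeU k m n → Prop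
  | KK (i j : Fin (m + n)) : URel q m n (fK k i * fK k j) (fK k j * fK k i)
  | KKinv (i : Fin (m + n)) : URel q m n (fK k i * fKinv k i) 1
  | KinvK (i : Fin (m + n)) : URel q m n (fKinv k i * fK k i) 1
  | KE (i : Fin (m + n)) (j : Fin (m + n - 1)) : URel q m n (fK k i * fE k j)
      ((qi q m i ^ ((if i = lo j then 1 else 0) - (if i = hi j then 1 else 0) : ℤ)) •
        (fE k j * fK k i))
  | KF (i : Fin (m + n)) (j : Fin (m + n - 1)) : URel q m n (fK k i * fF k j)
      ((qi q m i ^ ((if i = hi j then 1 else 0) - (if i = lo j then 1 else 0) : ℤ)) •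
        (fF k j * fK k i))
  | EF (i j : Fin (m + n - 1)) : URel q m n
      (fE k i * fF k j - ((-1 : k) ^ (par m i * par m j)) • (fF k j * fE k i))
      (if i = j then (qi q m i - (qi q m i)⁻¹)⁻¹ •
        (fK k (lo i) * fKinv k (hi i) - fK k (hi i) * fKinv k (lo i)) else 0)
  | EE (i j : Fin (m + n - 1)) (h : i.1 + 1 < j.1) : URel q m n (fE k i * fE k j) (fE k j * fE k i)
  | FF (i j : Fin (m + n - 1)) (h : i.1 + 1 < j.1) : URel q m n (fF k i * fF k j) (fF k j * fF k i)
  | serreE (i j : Fin (m + n - 1)) (hij : i.1 + 1 = j.1 ∨ j.1 + 1 = i.1) (hi : i.1 + 1 ≠ m) :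
      URel q m n (serre3 q (fE k i) (fE k j)) 0
  | serreF (i j : Fin (m + n - 1)) (hij : i.1 + 1 = j.1 ∨ j.1 + 1 = i.1) (hi : i.1 + 1 ≠ m) :
      URel q m n (serre3 q (fF k i) (fF k j)) 0
  | oddE (j : Fin (m + n - 1)) (hj : j.1 + 1 = m) : URel q m n (fE k j * fE k j) 0
  | oddF (j : Fin (m + n - 1)) (hj : j.1 + 1 = m) : URel q m n (fF k j * fF k j) 0
  | extraE (a b c : Fin (m + n - 1)) (hb : b.1 + 1 = m) (ha : a.1 + 1 = b.1) (hc : b.1 + 1 = c.1) :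
      URel q m n (serre4 q (fE k a) (fE k b) (fE k c)) 0
  | extraF (a b c : Fin (m + n - 1)) (hb : b.1 + 1 = m) (ha : a.1 + 1 = b.1) (hc : b.1 + 1 = c.1) :
      URel q m n (serre4 q (fF k a) (fF k b) (fF k c)) 0
  | sigma_sq : URel q m n (fS k * fS k) 1
  | sigmaE (j : Fin (m + n - 1)) :
      URel q m n (fS k * fE k j * fS k) ((-1 : k) ^ par m j • fE k j)
  | sigmaF (j : Fin (m + n - 1)) :
      URel q m n (fS k * fF k j * fS k) ((-1 : k) ^ par m j • fF k j)
  | sigmaK (i : Fin (m + n)) : URel q m n (fS k * fK k i * fS k) (fK k i)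

/-- The bosonization `𝒰_q(gl(m|n))`. -/
abbrev UGl (q : k) (m n : ℕ) : Type u := RingQuot (URel q m n)

/-- The image in `𝒰_q(gl(m|n))` of an element of the free algebra. -/
def UGl.mk (q : k) (m n : ℕ) : FreeU k m n →ₐ[k] UGl q m n := RingQuot.mkAlgHom k (URel q m n)

/-- `E_j ∈ 𝒰_q(gl(m|n))`. -/
def UGl.E (q : k) (m n : ℕ) (j : Fin (m + n - 1)) : UGl q m n := UGl.mk q m n (fE k j)
/-- `F_j ∈ 𝒰_q(gl(m|n))`. -/
def UGl.F (q : k) (m n : ℕ) (j : Fin (m + n - 1)) : UGl q m n := UGl.mk q m n (fF k j)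
/-- `K_i ∈ 𝒰_q(gl(m|n))`. -/
def UGl.K (q : k) (m n : ℕ) (i : Fin (m + n)) : UGl q m n := UGl.mk q m n (fK k i)
/-- `σ ∈ 𝒰_q(gl(m|n))`. -/
def UGl.S (q : k) (m n : ℕ) : UGl q m n := UGl.mk q m n (fS k)
/-- `𝒦_j = K_j K_{j+1}⁻¹ ∈ 𝒰_q(gl(m|n))`. -/
def UGl.calK (q : k) (m n : ℕ) (j : Fin (m + n - 1)) : UGl q m n :=
  UGl.mk q m n (fK k (lo j) * fKinv k (hi j))
/-- `𝒦_j⁻¹ = K_{j+1} K_j⁻¹ ∈ 𝒰_q(gl(m|n))`. -/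
def UGl.calKinv (q : k) (m n : ℕ) (j : Fin (m + n - 1)) : UGl q m n :=
  UGl.mk q m n (fK k (hi j) * fKinv k (lo j))

/-- `𝒰_q(sl(m|n))`, the subalgebra of `𝒰_q(gl(m|n))` generated by the `E_j`, `F_j`, `𝒦_j^{±1}`
and `σ`. -/
def USl (q : k) (m n : ℕ) : Subalgebra k (UGl q m n) :=
  Algebra.adjoin k (Set.range (UGl.E q m n) ∪ Set.range (UGl.F q m n) ∪
    Set.range (UGl.calK q m n) ∪ Set.range (UGl.calKinv q m n) ∪ {UGl.S q m n})

/-- `E_j ∈ 𝒰_q(sl(m|n))`. -/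
def USl.E (q : k) (m n : ℕ) (j : Fin (m + n - 1)) : USl q m n :=
  ⟨UGl.E q m n j, Algebra.subset_adjoin (by simp)⟩
/-- `F_j ∈ 𝒰_q(sl(m|n))`. -/
def USl.F (q : k) (m n : ℕ) (j : Fin (m + n - 1)) : USl q m n :=
  ⟨UGl.F q m n j, Algebra.subset_adjoin (by simp)⟩
/-- `𝒦_j ∈ 𝒰_q(sl(m|n))`. -/
def USl.calK (q : k) (m n : ℕ) (j : Fin (m + n - 1)) : USl q m n :=
  ⟨UGl.calK q m n j, Algebra.subset_adjoin (by simp)⟩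
/-- `σ ∈ 𝒰_q(sl(m|n))`. -/
def USl.S (q : k) (m n : ℕ) : USl q m n :=
  ⟨UGl.S q m n, Algebra.subset_adjoin (by simp)⟩

/-- The additional relations of the restricted quotient, with `ℓ = char(q)`:
`E_j^ℓ = F_j^ℓ = 0` for even `E_j`, `F_j`, `E_j^2 = F_j^2 = 0` for the odd ones, and
`T_i^{2ℓ} = 1` for the toral generators `T_i`. -/
inductive RestrRel {A : Type u} [Ring A] {J I : Type} (odd : J → Prop) (ℓ : ℕ)
    (E F : J → A) (T : I → A) : A → A → Prop
  | evenE (j : J) (h : ¬ odd j) : RestrRel odd ℓ E F T (E j ^ ℓ) 0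
  | evenF (j : J) (h : ¬ odd j) : RestrRel odd ℓ E F T (F j ^ ℓ) 0
  | oddE (j : J) (h : odd j) : RestrRel odd ℓ E F T (E j ^ 2) 0
  | oddF (j : J) (h : odd j) : RestrRel odd ℓ E F T (F j ^ 2) 0
  | toral (i : I) : RestrRel odd ℓ E F T (T i ^ (2 * ℓ)) 1

/-- The quotient of an algebra by these relations. -/
abbrev Restr {A : Type u} [Ring A] {J I : Type} (odd : J → Prop) (ℓ : ℕ)
    (E F : J → A) (T : I → A) : Type u :=
  RingQuot (RestrRel odd ℓ E F T)

/-- The restricted algebra `u_q(gl(m|n))`, a quotient of `𝒰_q(gl(m|n))`. -/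
abbrev uGl (q : k) (m n : ℕ) : Type u :=
  Restr (fun j : Fin (m + n - 1) => j.1 + 1 = m) (qChar q)
    (UGl.E q m n) (UGl.F q m n) (UGl.K q m n)

/-- The quotient map `𝒰_q(gl(m|n)) → u_q(gl(m|n))`. -/
def uGl.mk (q : k) (m n : ℕ) : UGl q m n →ₐ[k] uGl q m n := RingQuot.mkAlgHom k _

/-- The restricted algebra `u_q(sl(m|n))`, a quotient of `𝒰_q(sl(m|n))`. -/
abbrev uSl (q : k) (m n : ℕ) : Type u :=
  Restr (fun j : Fin (m + n - 1) => j.1 + 1 = m) (qChar q)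
    (USl.E q m n) (USl.F q m n) (USl.calK q m n)

/-- The quotient map `𝒰_q(sl(m|n)) → u_q(sl(m|n))`. -/
def uSl.mk (q : k) (m n : ℕ) : USl q m n →ₐ[k] uSl q m n := RingQuot.mkAlgHom k _

/-! ### Highest weight modules -/

section HighestWeight

variable {A : Type u} [Ring A] [Algebra k A] {J I : Type}

/-- The left ideal generated by all `E_j`, all `T_i - χ_i` and `s - ε`. -/
def hwIdeal (E : J → A) (T : I → A) (s : A) (χ : I → k) (ε : k) : Submodule A A :=
  Submodule.span A (Set.range E ∪ Set.range (fun i => T i - algebraMap k A (χ i)) ∪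
    {s - algebraMap k A ε})

/-- The Verma module: the universal module generated by a vector `v` with `E_j v = 0`,
`T_i v = χ_i v`, `s v = ε v`. -/
abbrev Verma (E : J → A) (T : I → A) (s : A) (χ : I → k) (ε : k) : Type u :=
  A ⧸ hwIdeal E T s χ ε

/-- The sum of the subspaces `F_j M` of the Verma module `M`, i.e. the span of everything strictly
below the highest weight vector. -/
def below (E F : J → A) (T : I → A) (s : A) (χ : I → k) (ε : k) :
    AddSubgroup (Verma E T s χ ε) :=
  ⨆ j, (DistribSMul.toAddMonoidHom (Verma E T s χ ε) (F j)).range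

/-- The sum of all submodules of the Verma module `M` which lie in `∑_j F_j M`, that is, in the span
of the weights strictly below the highest one: the maximal submodule in highest weight theory. -/
def maxSub (E F : J → A) (T : I → A) (s : A) (χ : I → k) (ε : k) :
    Submodule A (Verma E T s χ ε) :=
  sSup {N | ∀ x ∈ N, x ∈ below E F T s χ ε}

/-- The simple quotient of the Verma module. -/
abbrev SimpleQuot (E F : J → A) (T : I → A) (s : A) (χ : I → k) (ε : k) : Type u :=
  Verma E T s χ ε ⧸ maxSub E F T s χ ε

end HighestWeight

/-- `ε_a` in the weight lattice `ℤ^(m+n)` (index `a` starting at `0`). -/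
def eps (m n a : ℕ) : Fin (m + n) → ℤ := fun i => if i.1 = a then 1 else 0

/-- The fundamental weight `ω_t = ε_1 + ⋯ + ε_t`. -/
def omega (m n t : ℕ) : Fin (m + n) → ℤ := ∑ a ∈ Finset.range t, eps m n a

/-- The weight `ω_m + (ℓ-1) ε_{m+1} + ⋯ + (ℓ-1) ε_{m+i-1} + r ε_{m+i}` (`1 ≤ i ≤ n`). -/
def stairWt (m n ℓ i r : ℕ) : Fin (m + n) → ℤ :=
  omega m n m + ∑ a ∈ Finset.range (i - 1), ((ℓ : ℤ) - 1) • eps m n (m + a) +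
    (r : ℤ) • eps m n (m + (i - 1))

/-- The eigenvalue `q^{(wt, ε_i)} = q_i^{wt_i}` of `K_i` on a vector of weight `wt`. -/
def chiK (q : k) {m n : ℕ} (wt : Fin (m + n) → ℤ) (i : Fin (m + n)) : k := qi q m i ^ wt i

/-- The eigenvalue of `𝒦_j = K_j K_{j+1}⁻¹` on a vector of weight `wt`. -/
def chiCalK (q : k) {m n : ℕ} (wt : Fin (m + n) → ℤ) (j : Fin (m + n - 1)) : k :=
  chiK q wt (lo j) * (chiK q wt (hi j))⁻¹

/-- The eigenvalue `(-1)^(wt_{m+1} + ⋯ + wt_{m+n})` of the parity element `σ` on a vector of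
weight `wt`. -/
def chiS (k : Type u) [Field k] {m n : ℕ} (wt : Fin (m + n) → ℤ) : k :=
  (-1) ^ ∑ i : Fin (m + n), if m ≤ i.1 then wt i else 0

/-- The `𝒰_q(gl(m|n))`-module `V(wt)`. -/
abbrev VGl (q : k) {m n : ℕ} (wt : Fin (m + n) → ℤ) : Type u :=
  SimpleQuot (UGl.E q m n) (UGl.F q m n) (UGl.K q m n) (UGl.S q m n) (chiK q wt) (chiS k wt)

/-- The `𝒰_q(sl(m|n))`-module `V(wt)`. -/
abbrev VSl (q : k) {m n : ℕ} (wt : Fin (m + n) → ℤ) : Type u :=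
  SimpleQuot (USl.E q m n) (USl.F q m n) (USl.calK q m n) (USl.S q m n) (chiCalK q wt) (chiS k wt)

/-- The `u_q(gl(m|n))`-module `V(wt)`. -/
abbrev vGl (q : k) {m n : ℕ} (wt : Fin (m + n) → ℤ) : Type u :=
  SimpleQuot (fun j => uGl.mk q m n (UGl.E q m n j)) (fun j => uGl.mk q m n (UGl.F q m n j))
    (fun i => uGl.mk q m n (UGl.K q m n i)) (uGl.mk q m n (UGl.S q m n)) (chiK q wt) (chiS k wt)

/-- The `u_q(sl(m|n))`-module `V(wt)`. -/
abbrev vSl (q : k) {m n : ℕ} (wt : Fin (m + n) → ℤ) : Type u :=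
  SimpleQuot (fun j => uSl.mk q m n (USl.E q m n j)) (fun j => uSl.mk q m n (USl.F q m n j))
    (fun j => uSl.mk q m n (USl.calK q m n j)) (uSl.mk q m n (USl.S q m n))
    (chiCalK q wt) (chiS k wt)

/-- The module `V` over the `k`-algebra `A` is simple, and its dimension over `k` is `d`. -/
def SimpleOfDim (k A V : Type u) [Field k] [Ring A] [AddCommGroup V] [Module k V] [Module A V]
    (d : ℕ) : Prop :=
  IsSimpleModule A V ∧ Module.rank k V = d

end QuantumGrassmann
end

/-! The component of degree `t` of the dual Grassmann superalgebra has the basis `x^a`, where `a`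
runs over the exponents in `ℤ^(m+n)` with sum `t` whose first `m` entries are `0` or `1` and whose
last `n` entries are nonnegative, and at most `ℓ - 1` in the restricted case. On it `E_j` acts as
`x_j ∂_{j+1}` and `F_j` as `x_{j+1} ∂_j`. In a divided power variable multiplication takes `x^(b)`
to `[b+1] x^(b+1)` and `∂` takes `x^(b)` to `x^(b-1)`, while in an exterior variable both
coefficients are `1` whenever the target exponent is allowed. The generators `K_i` and `σ` are
diagonal. With this normalization neither powers of `q` nor signs enter the coefficients of `E_j`
and `F_j`.

Operators are written on all functions on `ℤ^(m+n)`, as products of one-coordinate operators; those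
in different coordinates commute. Each Serre relation thus becomes an identity in a single
coordinate, namely the recursion `[x+1] + [x-1] = (q + q⁻¹)[x]` or the vanishing of the square of an
exterior operator. The relation between `E_j` and `F_j` is an identity of quantum integers that
needs admissible exponents (`coeff_comm_eq`), so the action is one of `𝒰_q` on `wtSpace` only. The
restricted relations hold there as well, because `ℓ` applications of `E_j` or `F_j` leave the
admissible range and `q^(2ℓ) = 1`.

Simplicity comes from `IsHighest.unique`: exactly one exponent at most admits no further `E_j`. The
coefficient of a transition between exponents is nonzero whenever source and target are admissible
(`coeffE_ne_zero_iff`, `coeffF_ne_zero_iff`). Hence a nonzero subspace stable under all `E_j`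
contains the highest basis vector, and the `F_j` recover every other basis vector from it. The
argument follows supports and never separates weight spaces, so it is insensitive to coincidences of
weights at roots of unity or over `sl`.

A simple module with a highest weight vector outside `∑ F_j W` is the simple quotient of the Verma
module (`IsTriangular.simpleOfDim`); this needs only that the `F_j` can be moved to the left. It
remains to identify the highest exponent, to prove that the monomials of `Ω_q^!` are linearly
independent (`linearIndependent_extMono`), and to count them, in the restricted case with the
generating function `((1 - X^ℓ)/(1 - X))^n`. -/

open scoped TensorProduct

noncomputable section

namespace QuantumGrassmann

universe u

variable {k : Type u} [Field k]

/-! ### Highest weight modules over algebras with a triangular structure -/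

section Triangular

variable {A : Type u} [Ring A] [Algebra k A] {J I : Type}

/-- The algebra `A` is generated by `E`, `F`, the toral elements `T`, `T'` and `s`, and these
generators can be reordered so that the `F_j` come first. -/
structure IsTriangular (k : Type u) [Field k] {A : Type u} [Ring A] [Algebra k A] {J I : Type}
    (E F : J → A) (T T' : I → A) (s : A) : Prop where
  adjoin_eq_top :
    Algebra.adjoin k (Set.range E ∪ Set.range F ∪ Set.range T ∪ Set.range T' ∪ {s}) = ⊤
  inv_mul : ∀ i, T' i * T i = 1
  T_F : ∀ i j, ∃ c : k, T i * F j = c • (F j * T i)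
  inv_F : ∀ i j, ∃ c : k, T' i * F j = c • (F j * T' i)
  s_F : ∀ j, ∃ c : k, s * F j = c • (F j * s)
  E_F : ∀ i j, ∃ c : k, ∃ h ∈ Algebra.adjoin k (Set.range T ∪ Set.range T'),
    E i * F j = c • (F j * E i) + h

variable {E F : J → A} {T T' : I → A} {s : A}

/-- Passes the structure from `𝒰_q` to its restricted quotient. -/
theorem IsTriangular.map (h : IsTriangular k E F T T' s) {B : Type u} [Ring B] [Algebra k B]
    (f : A →ₐ[k] B) (hf : Function.Surjective f) :
    IsTriangular k (fun j => f (E j)) (fun j => f (F j)) (fun i => f (T i)) (fun i => f (T' i))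
      (f s) where
  adjoin_eq_top := by
    have h1 := congrArg (Subalgebra.map f) h.adjoin_eq_top
    rw [AlgHom.map_adjoin, Algebra.map_top, (AlgHom.range_eq_top f).2 hf] at h1
    simp only [Set.image_union, Set.image_singleton, ← Set.range_comp] at h1
    exact h1
  inv_mul i := by rw [← map_mul, h.inv_mul, map_one]
  T_F i j := by
    obtain ⟨c, hc⟩ := h.T_F i j
    exact ⟨c, by simp only [← map_mul, hc, map_smul]⟩
  inv_F i j := by
    obtain ⟨c, hc⟩ := h.inv_F i j
    exact ⟨c, by simp only [← map_mul, hc, map_smul]⟩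
  s_F j := by
    obtain ⟨c, hc⟩ := h.s_F j
    exact ⟨c, by simp only [← map_mul, hc, map_smul]⟩
  E_F i j := by
    obtain ⟨c, x, hx, hc⟩ := h.E_F i j
    refine ⟨c, f x, ?_, by simp only [← map_mul, hc, map_smul, map_add]⟩
    have h1 : f x ∈ (Algebra.adjoin k (Set.range T ∪ Set.range T')).map f := ⟨x, hx, rfl⟩
    rw [AlgHom.map_adjoin, Set.image_union, ← Set.range_comp, ← Set.range_comp] at h1
    exact h1

variable (E T s) in
/-- The highest weight vector of the Verma module. -/
def vermaGen (χ : I → k) (ε : k) : Verma E T s χ ε := Submodule.Quotient.mk 1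

theorem smul_vermaGen_eq_zero {χ : I → k} {ε : k} {a : A} (ha : a ∈ hwIdeal E T s χ ε) :
    a • vermaGen E T s χ ε = 0 := by
  rw [vermaGen, ← Submodule.Quotient.mk_smul, smul_eq_mul, mul_one]
  exact (Submodule.Quotient.mk_eq_zero _).2 ha

theorem smul_vermaGen (χ : I → k) (ε : k) (a : A) :
    a • vermaGen E T s χ ε = Submodule.Quotient.mk a := by
  rw [vermaGen, ← Submodule.Quotient.mk_smul, smul_eq_mul, mul_one]

theorem E_smul_vermaGen (χ : I → k) (ε : k) (j : J) : E j • vermaGen E T s χ ε = 0 :=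
  smul_vermaGen_eq_zero (Submodule.subset_span (by simp))

theorem T_smul_vermaGen (χ : I → k) (ε : k) (i : I) :
    T i • vermaGen E T s χ ε = χ i • vermaGen E T s χ ε := by
  rw [← sub_eq_zero, ← algebraMap_smul A (χ i), ← sub_smul]
  exact smul_vermaGen_eq_zero (Submodule.subset_span (by simp))

theorem s_smul_vermaGen (χ : I → k) (ε : k) :
    s • vermaGen E T s χ ε = ε • vermaGen E T s χ ε := by
  rw [← sub_eq_zero, ← algebraMap_smul A ε, ← sub_smul]
  exact smul_vermaGen_eq_zero (Submodule.subset_span (by simp))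

/-- The subalgebra of the elements which stabilize a subspace of a module. -/
def stabilizerAlg {M : Type u} [AddCommGroup M] [Module k M] [Module A M] [IsScalarTower k A M]
    (P : Submodule k M) : Subalgebra k A where
  carrier := {a | ∀ x ∈ P, a • x ∈ P}
  mul_mem' ha hb x hx := by rw [mul_smul]; exact ha _ (hb _ hx)
  add_mem' ha hb x hx := by rw [add_smul]; exact P.add_mem (ha _ hx) (hb _ hx)
  algebraMap_mem' c x hx := by rw [algebraMap_smul]; exact P.smul_mem c hx

/-- The elements of `A` that stabilize the span of the words in the `F_j` applied to the highest
weight vector form a subalgebra. Moving a generator to the right through a word shows that it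
contains all generators, so it is everything. -/
theorem IsTriangular.span_words_eq_top (h : IsTriangular k E F T T' s) (χ : I → k) (ε : k) :
    Submodule.span k (Set.range fun l : List J => (l.map F).prod • vermaGen E T s χ ε) = ⊤ := by
  set v := vermaGen E T s χ ε with hv
  set P := Submodule.span k (Set.range fun l : List J => (l.map F).prod • v) with hP
  have hvP : v ∈ P := Submodule.subset_span ⟨[], by simp⟩
  have stab : ∀ a : A, (∀ l : List J, a • (l.map F).prod • v ∈ P) →
      a ∈ stabilizerAlg (A := A) P := by
    intro a ha x hx
    induction hx using Submodule.span_induction with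
    | mem x hx => obtain ⟨l, rfl⟩ := hx; exact ha l
    | zero => rw [smul_zero]; exact P.zero_mem
    | add x y _ _ hx hy => rw [smul_add]; exact P.add_mem hx hy
    | smul c x _ hx => rw [smul_comm]; exact P.smul_mem c hx
  have hF : ∀ j, F j ∈ stabilizerAlg (A := A) P := fun j => stab _ fun l =>
    Submodule.subset_span ⟨j :: l, by simp [mul_smul]⟩
  have comm : ∀ a : A, a • v ∈ P → (∀ j, ∃ c : k, a * F j = c • (F j * a)) →
      a ∈ stabilizerAlg (A := A) P := by
    intro a hav hc
    refine stab a fun l => ?_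
    induction l with
    | nil => simpa using hav
    | cons j l ih =>
      obtain ⟨c, hc⟩ := hc j
      rw [List.map_cons, List.prod_cons, mul_smul, ← mul_smul, hc, smul_assoc, mul_smul]
      exact P.smul_mem c (hF j _ ih)
  have hT : ∀ i, T i ∈ stabilizerAlg (A := A) P := fun i => comm _
    (by rw [T_smul_vermaGen]; exact P.smul_mem _ hvP) (h.T_F i)
  have hT' : ∀ i, T' i ∈ stabilizerAlg (A := A) P := fun i => comm _ (by
    -- Since `v = T'_i T_i v = χ_i T'_i v`, the vector `T'_i v` is a multiple of `v` if `χ_i ≠ 0`,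
    -- and `v = 0` otherwise.
    have h1 : T' i • T i • v = v := by rw [← mul_smul, h.inv_mul, one_smul]
    rw [T_smul_vermaGen, smul_comm] at h1
    by_cases h0 : χ i = 0
    · rw [h0, zero_smul] at h1
      rw [← h1, smul_zero]; exact P.zero_mem
    · rw [show T' i • v = (χ i)⁻¹ • v by rw [eq_inv_smul_iff₀ h0]; exact h1]
      exact P.smul_mem _ hvP) (h.inv_F i)
  have hs : s ∈ stabilizerAlg (A := A) P := comm _
    (by rw [s_smul_vermaGen]; exact P.smul_mem _ hvP) h.s_F
  have htor : Algebra.adjoin k (Set.range T ∪ Set.range T') ≤ stabilizerAlg (A := A) P := by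
    rw [Algebra.adjoin_le_iff]
    rintro _ (⟨i, rfl⟩ | ⟨i, rfl⟩)
    exacts [hT i, hT' i]
  have hE : ∀ i, E i ∈ stabilizerAlg (A := A) P := fun i => stab _ fun l => by
    induction l with
    | nil => simp only [List.map_nil, List.prod_nil, one_smul, hv, E_smul_vermaGen]; exact P.zero_mem
    | cons j l ih =>
      obtain ⟨c, x, hx, hc⟩ := h.E_F i j
      rw [List.map_cons, List.prod_cons, mul_smul, ← mul_smul, hc, add_smul, smul_assoc, mul_smul]
      exact P.add_mem (P.smul_mem c (hF j _ ih))
        (htor hx _ (Submodule.subset_span ⟨l, rfl⟩))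
  have htop : stabilizerAlg (A := A) P = ⊤ := by
    rw [eq_top_iff, ← h.adjoin_eq_top, Algebra.adjoin_le_iff]
    rintro _ ((((⟨i, rfl⟩ | ⟨i, rfl⟩) | ⟨i, rfl⟩) | ⟨i, rfl⟩) | rfl)
    exacts [hE i, hF i, hT i, hT' i, hs]
  rw [eq_top_iff]
  rintro x -
  obtain ⟨a, rfl⟩ := Submodule.Quotient.mk_surjective _ x
  rw [← smul_vermaGen]
  have : a ∈ stabilizerAlg (A := A) P := by rw [htop]; trivial
  exact this _ hvP

theorem smul_mem_below {χ : I → k} {ε : k} (c : k) {x : Verma E T s χ ε}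
    (hx : x ∈ below E F T s χ ε) : c • x ∈ below E F T s χ ε := by
  rw [below] at hx ⊢
  induction hx using AddSubgroup.iSup_induction' with
  | hp j x hx =>
    obtain ⟨y, rfl⟩ := hx
    refine AddSubgroup.mem_iSup_of_mem j ⟨c • y, ?_⟩
    simp only [DistribSMul.toAddMonoidHom_apply]
    exact smul_comm _ _ _
  | h1 => rw [smul_zero]; exact AddSubgroup.zero_mem _
  | hadd x y _ _ hx hy => rw [smul_add]; exact AddSubgroup.add_mem _ hx hy

theorem IsTriangular.exists_eq_smul_add (h : IsTriangular k E F T T' s) (χ : I → k) (ε : k)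
    (x : Verma E T s χ ε) :
    ∃ c : k, ∃ y ∈ below E F T s χ ε, x = c • vermaGen E T s χ ε + y := by
  have hx : x ∈ Submodule.span k
      (Set.range fun l : List J => (l.map F).prod • vermaGen E T s χ ε) := by
    rw [h.span_words_eq_top]; trivial
  induction hx using Submodule.span_induction with
  | mem x hx =>
    obtain ⟨l, rfl⟩ := hx
    cases l with
    | nil => exact ⟨1, 0, AddSubgroup.zero_mem _, by simp⟩
    | cons j l =>
      refine ⟨0, _, AddSubgroup.mem_iSup_of_mem j
        ⟨(l.map F).prod • vermaGen E T s χ ε, rfl⟩, ?_⟩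
      simp [mul_smul]
  | zero => exact ⟨0, 0, AddSubgroup.zero_mem _, by simp⟩
  | add x y _ _ hx hy =>
    obtain ⟨c, x', hx', rfl⟩ := hx
    obtain ⟨d, y', hy', rfl⟩ := hy
    exact ⟨c + d, x' + y', AddSubgroup.add_mem _ hx' hy', by rw [add_smul]; abel⟩
  | smul a x _ hx =>
    obtain ⟨c, x', hx', rfl⟩ := hx
    exact ⟨a * c, a • x', smul_mem_below a hx', by rw [smul_add, mul_smul]⟩

/-- A simple representation generated by a highest weight vector which is not a combination of
vectors `F_j x` realizes the simple quotient of the Verma module. -/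
theorem IsTriangular.simpleOfDim (h : IsTriangular k E F T T' s) {χ : I → k} {ε : k}
    {W : Type u} [AddCommGroup W] [Module k W] (ρ : A →ₐ[k] Module.End k W) (w : W)
    (hE : ∀ j, ρ (E j) w = 0) (hT : ∀ i, ρ (T i) w = χ i • w) (hs : ρ s w = ε • w)
    (hw : w ∉ ⨆ j, LinearMap.range (ρ (F j)))
    (hsimple : ∀ U : Submodule k W, U ≠ ⊥ → (∀ j, ∀ x ∈ U, ρ (E j) x ∈ U) →
      (∀ j, ∀ x ∈ U, ρ (F j) x ∈ U) → U = ⊤) {d : ℕ} (hd : Module.rank k W = d) :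
    SimpleOfDim k A (SimpleQuot E F T s χ ε) d := by
  let _ : Module A W := Module.compHom W ρ.toRingHom
  have smul_def : ∀ (a : A) (x : W), a • x = ρ a x := fun _ _ => rfl
  have : IsScalarTower k A W := ⟨fun c a x => by simp [smul_def]⟩
  have hw0 : w ≠ 0 := fun h0 => hw (h0 ▸ Submodule.zero_mem _)
  have : Nontrivial W := ⟨⟨w, 0, hw0⟩⟩
  have hsim : IsSimpleModule A W := by
    rw [isSimpleModule_iff]
    refine { eq_bot_or_eq_top := fun U => ?_ }
    by_cases hU : U = ⊥
    · exact Or.inl hU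
    refine Or.inr ?_
    have := hsimple (U.restrictScalars k) (by rwa [Ne, Submodule.restrictScalars_eq_bot_iff])
      (fun j x hx => U.smul_mem (E j) hx) (fun j x hx => U.smul_mem (F j) hx)
    rwa [Submodule.restrictScalars_eq_top_iff] at this
  let φ : Verma E T s χ ε →ₗ[A] W := Submodule.liftQ _ (LinearMap.toSpanSingleton A W w) (by
    rw [hwIdeal, Submodule.span_le]
    rintro _ ((⟨j, rfl⟩ | ⟨i, rfl⟩) | rfl)
    · simp [smul_def, hE]
    · simp [smul_def, hT, Algebra.algebraMap_eq_smul_one]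
    · simp [smul_def, hs, Algebra.algebraMap_eq_smul_one])
  have hφv : φ (vermaGen E T s χ ε) = w := by simp [φ, vermaGen]
  have hφ : Function.Surjective φ := by
    rw [← LinearMap.range_eq_top]
    refine (eq_bot_or_eq_top _).resolve_left fun hb => hw0 ?_
    rw [← hφv, ← Submodule.mem_bot (R := A), ← hb]
    exact ⟨_, rfl⟩
  have hφk : ∀ (c : k) (x : Verma E T s χ ε), φ (c • x) = c • φ x := fun c x => by
    rw [← algebraMap_smul A c x, map_smul, algebraMap_smul]
  have hbelow : ∀ x ∈ below E F T s χ ε, φ x ∈ ⨆ j, LinearMap.range (ρ (F j)) := by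
    intro x hx
    rw [below] at hx
    induction hx using AddSubgroup.iSup_induction' with
    | hp j x hx =>
      obtain ⟨y, rfl⟩ := hx
      refine Submodule.mem_iSup_of_mem j ⟨φ y, ?_⟩
      rw [← smul_def, ← map_smul]; rfl
    | h1 => rw [map_zero]; exact Submodule.zero_mem _
    | hadd x y _ _ hx hy => rw [map_add]; exact Submodule.add_mem _ hx hy
  have hker : LinearMap.ker φ = maxSub E F T s χ ε := by
    apply le_antisymm
    -- The kernel is itself one of the submodules in the supremum: for `c v + y` in the kernel with
    -- `y` below the top, `c w` lies in `∑ F_j W`, which does not contain `w`, so `c = 0`.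
    · refine le_sSup fun x hx => ?_
      obtain ⟨c, y, hy, rfl⟩ := h.exists_eq_smul_add χ ε x
      have h1 : c • w + φ y = 0 := by
        have := LinearMap.mem_ker.1 hx
        rwa [map_add, hφk, hφv] at this
      have hc : c = 0 := by
        by_contra hc
        refine hw ?_
        rw [← Submodule.smul_mem_iff _ hc, eq_neg_of_add_eq_zero_left h1]
        exact Submodule.neg_mem _ (hbelow y hy)
      simpa [hc] using hy
    -- A submodule inside `∑ F_j M` has its image inside `∑ F_j W`, hence not all of `W`; by
    -- simplicity the image is zero.
    · refine sSup_le fun N hN => ?_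
      have h1 : Submodule.map φ N = ⊥ := by
        refine (eq_bot_or_eq_top _).resolve_right fun ht => hw ?_
        obtain ⟨x, hx, hxw⟩ : w ∈ Submodule.map φ N := by rw [ht]; trivial
        rw [← hxw]
        exact hbelow x (hN x hx)
      intro x hx
      rw [LinearMap.mem_ker, ← Submodule.mem_bot (R := A), ← h1]
      exact ⟨x, hx, rfl⟩
  let e : SimpleQuot E F T s χ ε ≃ₗ[A] W :=
    (Submodule.quotEquivOfEq _ _ hker.symm).trans (φ.quotKerEquivOfSurjective hφ)
  exact ⟨IsSimpleModule.congr e, by rw [(e.restrictScalars k).rank_eq, hd]⟩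

end Triangular

section Operators

/-! ### Quantum integers with integral argument -/

/-- The quantum integer `[x] = (q^x - q^(-x)) / (q - q⁻¹)` for an integer `x`. -/
def qZ (q : k) (x : ℤ) : k := (q ^ x - q ^ (-x)) / (q - q⁻¹)

theorem sub_inv_ne_zero {q : k} (hq0 : q ≠ 0) (hq1 : q ^ 2 ≠ 1) : q - q⁻¹ ≠ 0 := by
  intro h
  apply hq1
  have h1 := sub_eq_zero.1 h
  rw [pow_two]
  nth_rewrite 2 [h1]
  exact mul_inv_cancel₀ hq0

@[simp] theorem qZ_zero (q : k) : qZ q 0 = 0 := by simp [qZ]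

theorem qZ_one {q : k} (hq0 : q ≠ 0) (hq1 : q ^ 2 ≠ 1) : qZ q 1 = 1 := by
  simp [qZ, div_self (sub_inv_ne_zero hq0 hq1)]

theorem qZ_add_one_add_sub_one {q : k} (hq0 : q ≠ 0) (x : ℤ) :
    qZ q (x + 1) + qZ q (x - 1) = (q + q⁻¹) * qZ q x := by
  simp only [qZ]
  rw [← add_div, mul_div_assoc', neg_add, neg_sub, sub_eq_add_neg (1 : ℤ) x, zpow_add₀ hq0,
    zpow_add₀ hq0, zpow_sub₀ hq0, zpow_add₀ hq0 1]
  simp only [zpow_one, zpow_neg_one]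
  congr 1
  field_simp
  ring

/-- This is the commutator of `E_j` and `F_j` on two divided power variables with exponents `x` and
`y`. -/
theorem qZ_mul_sub {q : k} (hq0 : q ≠ 0) (hq1 : q ^ 2 ≠ 1) (x y : ℤ) :
    qZ q x * qZ q (y + 1) - qZ q y * qZ q (x + 1) = qZ q (x - y) := by
  have h := sub_inv_ne_zero hq0 hq1
  simp only [qZ]
  rw [div_mul_div_comm, div_mul_div_comm, ← sub_div, div_eq_div_iff (mul_ne_zero h h) h]
  simp only [neg_add, neg_sub, zpow_add₀ hq0, zpow_sub₀ hq0, zpow_neg, zpow_one]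
  field_simp
  ring

/-! ### Shift operators -/

section Shift

variable {N : ℕ}

/-- The operator `f ↦ (a ↦ c(a) f(a - δ))` on the functions on `ℤ^N`. -/
def shiftOp (c : (Fin N → ℤ) → k) (δ : Fin N → ℤ) : Module.End k ((Fin N → ℤ) → k) where
  toFun f a := c a * f (a - δ)
  map_add' f g := by ext a; simp [mul_add]
  map_smul' r f := by ext a; simp [mul_left_comm]

theorem shiftOp_apply (c : (Fin N → ℤ) → k) (δ : Fin N → ℤ) (f : (Fin N → ℤ) → k)
    (a : Fin N → ℤ) : shiftOp c δ f a = c a * f (a - δ) := rfl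

theorem shiftOp_mul (c c' : (Fin N → ℤ) → k) (δ δ' : Fin N → ℤ) :
    shiftOp c δ * shiftOp c' δ' = shiftOp (fun a => c a * c' (a - δ)) (δ + δ') := by
  ext f a
  simp [shiftOp_apply, sub_sub, mul_assoc]

/-- The operator `f ↦ (a ↦ c(a_i) f(a - z ε_i))`, which concerns the `i`-th coordinate only. -/
def locOp (i : Fin N) (c : ℤ → k) (z : ℤ) : Module.End k ((Fin N → ℤ) → k) :=
  shiftOp (fun a => c (a i)) (Pi.single i z)

theorem locOp_mul (i : Fin N) (c c' : ℤ → k) (z z' : ℤ) :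
    locOp i c z * locOp i c' z' = locOp i (fun x => c x * c' (x - z)) (z + z') := by
  simp [locOp, shiftOp_mul, Pi.single_add]

theorem locOp_commute {i j : Fin N} (hij : i ≠ j) (c c' : ℤ → k) (z z' : ℤ) :
    Commute (locOp i c z) (locOp j c' z') := by
  rw [Commute, SemiconjBy, locOp, locOp, shiftOp_mul, shiftOp_mul]
  rw [add_comm]
  congr 1
  ext a
  simp [Pi.single_eq_of_ne hij, Pi.single_eq_of_ne hij.symm, mul_comm]

theorem locOp_add (i : Fin N) (c c' : ℤ → k) (z : ℤ) :
    locOp i c z + locOp i c' z = locOp i (fun x => c x + c' x) z := by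
  ext f a
  simp [locOp, shiftOp_apply, add_mul]

theorem locOp_sub (i : Fin N) (c c' : ℤ → k) (z : ℤ) :
    locOp i c z - locOp i c' z = locOp i (fun x => c x - c' x) z := by
  ext f a
  simp [locOp, shiftOp_apply, sub_mul]

theorem locOp_smul (i : Fin N) (r : k) (c : ℤ → k) (z : ℤ) :
    r • locOp i c z = locOp i (fun x => r * c x) z := by
  ext f a
  simp [locOp, shiftOp_apply, mul_assoc]

theorem locOp_eq_zero (i : Fin N) {c : ℤ → k} (z : ℤ) (h : ∀ x, c x = 0) : locOp i c z = 0 := by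
  ext f a
  simp [locOp, shiftOp_apply, h]

end Shift

/-! ### Coefficients of the raising and lowering operators -/

/-- The coefficient of the raising operator in the `i`-th coordinate. -/
def raiseCoeff (q : k) (m i : ℕ) (x : ℤ) : k :=
  if i < m then (if x = 1 then 1 else 0) else qZ q x

/-- The coefficient of the lowering operator in the `i`-th coordinate. -/
def lowerCoeff (k : Type u) [Field k] (m i : ℕ) (x : ℤ) : k :=
  if i < m then (if x = 0 then 1 else 0) else if 0 ≤ x then 1 else 0

/-- The admissible exponents of the `i`-th variable. -/
def adm (q : k) (m i : ℕ) : Set ℤ :=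
  {x | 0 ≤ x ∧ if i < m then x ≤ 1 else ∀ y, 1 ≤ y → y ≤ x → qZ q y ≠ 0}

variable {q : k} {m : ℕ}

theorem nonneg_of_mem_adm {i : ℕ} {x : ℤ} (hx : x ∈ adm q m i) : 0 ≤ x := hx.1

theorem mem_adm_of_le {i : ℕ} {x y : ℤ} (hx : x ∈ adm q m i) (h0 : 0 ≤ y) (h : y ≤ x) :
    y ∈ adm q m i := by
  refine ⟨h0, ?_⟩
  have := hx.2
  split_ifs at this ⊢
  · omega
  · exact fun z h1 h2 => this z h1 (h2.trans h)

theorem zero_mem_adm (q : k) (m i : ℕ) : 0 ∈ adm q m i := by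
  refine ⟨le_rfl, ?_⟩
  split_ifs
  · omega
  · intro y h1 h2; omega

theorem one_mem_adm (hq0 : q ≠ 0) (hq1 : q ^ 2 ≠ 1) (m i : ℕ) : 1 ∈ adm q m i := by
  refine ⟨by omega, ?_⟩
  split_ifs
  · omega
  · intro y h1 h2
    rw [show y = 1 by omega, qZ_one hq0 hq1]
    exact one_ne_zero

/-- From an admissible exponent, raising fails only at the upper bound: an exterior exponent cannot
reach `2`, and a divided power exponent stops at the first `x` with `[x] = 0`. -/
theorem raiseCoeff_ne_zero_iff {i : ℕ} {x : ℤ} (hx : x - 1 ∈ adm q m i) :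
    raiseCoeff q m i x ≠ 0 ↔ x ∈ adm q m i := by
  obtain ⟨h0, h1⟩ := hx
  simp only [raiseCoeff, adm, Set.mem_ofPred_eq]
  split_ifs at h1 ⊢ with h2 h3
  · subst h3; simp
  · simp only [ne_eq, not_true_eq_false, false_iff]; omega
  · constructor
    · refine fun h => ⟨by omega, fun y hy hyx => ?_⟩
      rcases hyx.lt_or_eq with h3 | rfl
      · exact h1 y hy (by omega)
      · exact h
    · exact fun h => h.2 x (by omega) le_rfl

theorem lowerCoeff_ne_zero_iff {i : ℕ} {x : ℤ} (hx : x + 1 ∈ adm q m i) :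
    lowerCoeff k m i x ≠ 0 ↔ x ∈ adm q m i := by
  have h3 : x ∈ adm q m i ↔ 0 ≤ x := ⟨fun h => h.1, fun h => mem_adm_of_le hx h (by omega)⟩
  rw [h3]
  obtain ⟨h0, h1⟩ := hx
  simp only [lowerCoeff]
  split_ifs at h1 ⊢ with h2 h4 h4
  · simp [h4]
  · simp only [ne_eq, not_true_eq_false, false_iff]; omega
  · simpa
  · simpa using h4

section Ops

variable {N : ℕ}

/-- The raising operator in the `i`-th coordinate. -/
def raise (q : k) (m : ℕ) (i : Fin N) : Module.End k ((Fin N → ℤ) → k) :=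
  locOp i (raiseCoeff q m i) 1

/-- The lowering operator in the `i`-th coordinate. -/
def lower (k : Type u) [Field k] (m : ℕ) (i : Fin N) : Module.End k ((Fin N → ℤ) → k) :=
  locOp i (lowerCoeff k m i) (-1)

theorem raise_commute {i j : Fin N} : Commute (raise q m i) (raise q m j) := by
  by_cases h : i = j
  · rw [h]
  · exact locOp_commute h _ _ _ _

theorem lower_commute {i j : Fin N} : Commute (lower k m i) (lower k m j) := by
  by_cases h : i = j
  · rw [h]
  · exact locOp_commute h _ _ _ _

theorem raise_commute_lower {i j : Fin N} (h : i ≠ j) : Commute (raise q m i) (lower k m j) :=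
  locOp_commute h _ _ _ _

theorem lower_commute_raise {i j : Fin N} (h : i ≠ j) : Commute (lower k m i) (raise q m j) :=
  locOp_commute h _ _ _ _

theorem raise_mul_self {i : Fin N} (h : i.1 < m) : raise q m i * raise q m i = 0 := by
  rw [raise, locOp_mul]
  refine locOp_eq_zero _ _ fun x => ?_
  simp only [raiseCoeff, h, if_true]
  split_ifs <;> first | omega | simp

theorem lower_mul_self {i : Fin N} (h : i.1 < m) : lower k m i * lower k m i = 0 := by
  rw [lower, locOp_mul]
  refine locOp_eq_zero _ _ fun x => ?_
  simp only [lowerCoeff, h, if_true]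
  split_ifs <;> first | omega | simp

/-- Away from the boundary the three terms have the coefficients `[x+2]`, `(q + q⁻¹)[x+1]` and
`[x]`; at `x = 0` the cut-off of the last lowering is harmless because `[0] = 0`. -/
theorem lower_lower_raise (hq0 : q ≠ 0) {i : Fin N} (h : ¬ i.1 < m) :
    lower k m i * lower k m i * raise q m i - (q + q⁻¹) • (lower k m i * raise q m i * lower k m i) +
      raise q m i * lower k m i * lower k m i = 0 := by
  rw [lower, raise]
  simp only [locOp_mul, locOp_smul, locOp_sub, locOp_add, Int.reduceNeg, Int.reduceAdd]
  refine locOp_eq_zero _ _ fun x => ?_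
  simp only [raiseCoeff, lowerCoeff, h, if_false]
  have := qZ_add_one_add_sub_one hq0 (x + 1)
  rw [add_sub_cancel_right] at this
  rcases lt_trichotomy x 0 with hx | rfl | hx
  · simp [not_le.2 hx]
  · norm_num at this ⊢
    rw [this]; ring
  · rw [if_pos (by omega), if_pos (by omega), if_pos (by omega), if_pos (by omega)]
    rw [show x - -1 = x + 1 by ring, show x - -2 = x + 1 + 1 by ring]
    linear_combination this

/-- All terms share the factor `[x]`, and what remains is the recursion for `[x-1]`, `[x]`, `[x+1]`.
The exponents `0` and `1`, where lowering is cut off, are covered by `[0] = 0`. -/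
theorem raise_raise_lower (hq0 : q ≠ 0) (hq1 : q ^ 2 ≠ 1) {i : Fin N} (h : ¬ i.1 < m) :
    raise q m i * raise q m i * lower k m i - (q + q⁻¹) • (raise q m i * lower k m i * raise q m i) +
      lower k m i * raise q m i * raise q m i = 0 := by
  rw [lower, raise]
  simp only [locOp_mul, locOp_smul, locOp_sub, locOp_add, Int.reduceNeg, Int.reduceAdd]
  refine locOp_eq_zero _ _ fun x => ?_
  simp only [raiseCoeff, lowerCoeff, h, if_false]
  have := qZ_add_one_add_sub_one hq0 x
  rw [show x - -1 = x + 1 by ring, sub_zero]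
  by_cases hx : x < 0
  · simp [not_le.2 hx, show ¬ (1 ≤ x) by omega, show ¬ 2 ≤ x by omega]
  by_cases hx : x = 0
  · simp [hx]
  by_cases hx : x = 1
  · subst hx
    norm_num at this ⊢
    rw [this, qZ_one hq0 hq1]; ring
  · rw [if_pos (by omega), if_pos (by omega), if_pos (by omega)]
    linear_combination qZ q x * this

end Ops

/-! ### Serre relations for products of commuting elements -/

section Serre

variable {A : Type u} [Ring A] [Algebra k A]

/-- Two neighbouring root operators share one coordinate, in which `x` and `y` act. The other
factors `p` and `z` commute out to the two sides, and leave the cubic expression in `x` and `y` with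
`p * p` in front. -/
theorem serre3_mul_mul (q : k) {p x y z : A} (hpx : Commute p x) (hpy : Commute p y)
    (hpz : Commute p z) (hzx : Commute z x)
    (h : p * p * (x * x * y - (q + q⁻¹) • (x * y * x) + y * x * x) * z = 0) :
    serre3 q (p * x) (y * z) = 0 := by
  rw [← h, serre3]
  have c1 : ∀ {a b : A}, Commute a b → ∀ w, a * (b * w) = b * (a * w) := fun h w => by
    rw [← mul_assoc, h.eq, mul_assoc]
  simp only [mul_add, add_mul, mul_sub, sub_mul, smul_mul_assoc, mul_smul_comm, mul_assoc, hzx.eq,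
    c1 hpx.symm, c1 hpy.symm, c1 hpz.symm]

/-- Here `x`, `y` act in the last exterior coordinate and `l`, `r` in the first divided power one,
or conversely with raising and lowering exchanged. Terms with adjacent `x`'s vanish, so all
surviving ones contain `x y x`, and the rest is the cubic relation in `l` and `r`. -/
theorem serre4_mul_mul (q : k) {p x y l r z : A} (hpx : Commute p x) (hpl : Commute p l) (hpr : Commute p r) (hpz : Commute p z) (hlx : Commute l x)
    (hly : Commute l y) (hrx : Commute r x) (hry : Commute r y) (hzx : Commute z x)
    (hzy : Commute z y) (hzl : Commute z l) (hx : x * x = 0)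
    (h : l * l * r - (q + q⁻¹) • (l * r * l) + r * l * l = 0) :
    serre4 q (p * y) (x * l) (r * z) = 0 := by
  have hh : p * (x * y * x) * (l * l * r - (q + q⁻¹) • (l * r * l) + r * l * l) * z = 0 := by
    rw [h]; simp
  rw [← hh, serre4]
  have c1 : ∀ {a b : A}, Commute a b → ∀ w, a * (b * w) = b * (a * w) := fun h w => by
    rw [← mul_assoc, h.eq, mul_assoc]
  have hx' : ∀ w, x * (x * w) = 0 := fun w => by rw [← mul_assoc, hx, zero_mul]
  simp only [mul_add, add_mul, mul_sub, sub_mul, smul_mul_assoc, mul_smul_comm, mul_assoc,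
    hly.eq, hzy.eq, hzl.eq, c1 hpx.symm, c1 hpl.symm, c1 hpr.symm, c1 hpz.symm, c1 hlx, c1 hly,
    c1 hrx, c1 hry, c1 hzx, hx', mul_zero, zero_mul]
  abel

end Serre

end Operators

/-! ### The representation on monomials -/

variable (q : k) (m n : ℕ)

/-- The operator of `E_j`. -/
def opE (j : Fin (m + n - 1)) : Module.End k ((Fin (m + n) → ℤ) → k) :=
  raise q m (lo j) * lower k m (hi j)

/-- The operator of `F_j`. -/
def opF (j : Fin (m + n - 1)) : Module.End k ((Fin (m + n) → ℤ) → k) :=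
  raise q m (hi j) * lower k m (lo j)

/-- The total degree in the last `n` variables. -/
def oddDeg (a : Fin (m + n) → ℤ) : ℤ := ∑ i : Fin (m + n), if m ≤ i.1 then a i else 0

/-- The operators of the generators. -/
def genOp : Gen m n → Module.End k ((Fin (m + n) → ℤ) → k)
  | Gen.E j => opE q m n j
  | Gen.F j => opF q m n j
  | Gen.K i => shiftOp (fun a => qi q m i ^ a i) 0
  | Gen.Kinv i => shiftOp (fun a => qi q m i ^ (-a i)) 0
  | Gen.sigma => shiftOp (fun a => (-1) ^ oddDeg m n a) 0

/-- The action of the free algebra. -/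
def freeRep : FreeU k m n →ₐ[k] Module.End k ((Fin (m + n) → ℤ) → k) :=
  FreeAlgebra.lift k (genOp q m n)

/-- The exponents of the monomials of degree `t`. -/
def wtSet (t : ℤ) : Set (Fin (m + n) → ℤ) :=
  {a | (∀ i : Fin (m + n), a i ∈ adm q m i) ∧ ∑ i, a i = t}

/-- The functions supported on the exponents of the monomials of degree `t`. -/
def wtSpace (t : ℤ) : Submodule k ((Fin (m + n) → ℤ) → k) where
  carrier := {f | ∀ a, a ∉ wtSet q m n t → f a = 0}
  zero_mem' := fun _ _ => rfl
  add_mem' hf hg a ha := by simp [hf a ha, hg a ha]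
  smul_mem' c f hf a ha := by simp [hf a ha]

variable {q m n}

/-- The simple root `ε_j - ε_{j+1}`. -/
def root (j : Fin (m + n - 1)) : Fin (m + n) → ℤ := Pi.single (lo j) 1 - Pi.single (hi j) 1

theorem lo_ne_hi (j : Fin (m + n - 1)) : lo j ≠ hi j := by simp [lo, hi]

theorem root_apply (j : Fin (m + n - 1)) (i : Fin (m + n)) :
    root j i = (if i = lo j then 1 else 0) - (if i = hi j then 1 else 0) := by
  simp [root, Pi.single_apply]

@[simp] theorem root_lo (j : Fin (m + n - 1)) : root j (lo j) = 1 := by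
  simp [root_apply, lo_ne_hi]

@[simp] theorem root_hi (j : Fin (m + n - 1)) : root j (hi j) = -1 := by
  simp [root_apply, (lo_ne_hi j).symm]

theorem root_of_ne {j : Fin (m + n - 1)} {i : Fin (m + n)} (h1 : i ≠ lo j) (h2 : i ≠ hi j) :
    root j i = 0 := by
  simp [root_apply, h1, h2]

theorem sum_root (j : Fin (m + n - 1)) : ∑ i, root j i = 0 := by
  simp [root_apply]

theorem opE_apply (j : Fin (m + n - 1)) (f : (Fin (m + n) → ℤ) → k) (a : Fin (m + n) → ℤ) :
    opE q m n j f a =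
      raiseCoeff q m (lo j) (a (lo j)) * lowerCoeff k m (hi j) (a (hi j)) * f (a - root j) := by
  rw [opE, raise, lower, locOp, locOp, shiftOp_mul, shiftOp_apply, root]
  simp [Pi.single_eq_of_ne (lo_ne_hi j).symm, sub_eq_add_neg, Pi.single_neg]

theorem opF_apply (j : Fin (m + n - 1)) (f : (Fin (m + n) → ℤ) → k) (a : Fin (m + n) → ℤ) :
    opF q m n j f a =
      raiseCoeff q m (hi j) (a (hi j)) * lowerCoeff k m (lo j) (a (lo j)) * f (a + root j) := by
  rw [opF, raise, lower, locOp, locOp, shiftOp_mul, shiftOp_apply, root]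
  simp [Pi.single_eq_of_ne (lo_ne_hi j), sub_eq_add_neg, Pi.single_neg, add_comm]

theorem mem_wtSet_iff_of_sub_root {t : ℤ} {j : Fin (m + n - 1)} {a : Fin (m + n) → ℤ}
    (ha : a - root j ∈ wtSet q m n t) :
    a ∈ wtSet q m n t ↔ a (lo j) ∈ adm q m (lo j) ∧ a (hi j) ∈ adm q m (hi j) := by
  refine ⟨fun h => ⟨h.1 _, h.1 _⟩, fun h => ⟨fun i => ?_, ?_⟩⟩
  · by_cases h1 : i = lo j
    · rw [h1]; exact h.1
    by_cases h2 : i = hi j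
    · rw [h2]; exact h.2
    · simpa [root_of_ne h1 h2] using ha.1 i
  · simpa [sum_root] using ha.2

theorem mem_wtSet_iff_of_add_root {t : ℤ} {j : Fin (m + n - 1)} {a : Fin (m + n) → ℤ}
    (ha : a + root j ∈ wtSet q m n t) :
    a ∈ wtSet q m n t ↔ a (lo j) ∈ adm q m (lo j) ∧ a (hi j) ∈ adm q m (hi j) := by
  refine ⟨fun h => ⟨h.1 _, h.1 _⟩, fun h => ⟨fun i => ?_, ?_⟩⟩
  · by_cases h1 : i = lo j
    · rw [h1]; exact h.1
    by_cases h2 : i = hi j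
    · rw [h2]; exact h.2
    · simpa [root_of_ne h1 h2] using ha.1 i
  · simpa [sum_root, Finset.sum_add_distrib] using ha.2

/-- This equivalence serves twice: a vanishing coefficient at inadmissible targets makes `wtSpace`
stable, and a nonvanishing one at admissible targets gives simplicity. -/
theorem coeffE_ne_zero_iff {t : ℤ} {j : Fin (m + n - 1)} {a : Fin (m + n) → ℤ}
    (ha : a - root j ∈ wtSet q m n t) :
    raiseCoeff q m (lo j) (a (lo j)) * lowerCoeff k m (hi j) (a (hi j)) ≠ 0 ↔
      a ∈ wtSet q m n t := by
  rw [mem_wtSet_iff_of_sub_root ha, mul_ne_zero_iff, raiseCoeff_ne_zero_iff,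
    lowerCoeff_ne_zero_iff (q := q)]
  · simpa using ha.1 (hi j)
  · simpa using ha.1 (lo j)

theorem coeffF_ne_zero_iff {t : ℤ} {j : Fin (m + n - 1)} {a : Fin (m + n) → ℤ}
    (ha : a + root j ∈ wtSet q m n t) :
    raiseCoeff q m (hi j) (a (hi j)) * lowerCoeff k m (lo j) (a (lo j)) ≠ 0 ↔
      a ∈ wtSet q m n t := by
  rw [mem_wtSet_iff_of_add_root ha, mul_ne_zero_iff, raiseCoeff_ne_zero_iff,
    lowerCoeff_ne_zero_iff (q := q), and_comm]
  · simpa using ha.1 (lo j)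
  · simpa [sub_eq_add_neg] using ha.1 (hi j)

theorem opE_mem {t : ℤ} {j : Fin (m + n - 1)} {f : (Fin (m + n) → ℤ) → k}
    (hf : f ∈ wtSpace q m n t) : opE q m n j f ∈ wtSpace q m n t := by
  intro a ha
  rw [opE_apply]
  by_cases h : a - root j ∈ wtSet q m n t
  · rw [not_not.1 (mt (coeffE_ne_zero_iff h).1 ha), zero_mul]
  · rw [hf _ h, mul_zero]

theorem opF_mem {t : ℤ} {j : Fin (m + n - 1)} {f : (Fin (m + n) → ℤ) → k}
    (hf : f ∈ wtSpace q m n t) : opF q m n j f ∈ wtSpace q m n t := by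
  intro a ha
  rw [opF_apply]
  by_cases h : a + root j ∈ wtSet q m n t
  · rw [not_not.1 (mt (coeffF_ne_zero_iff h).1 ha), zero_mul]
  · rw [hf _ h, mul_zero]

theorem freeRep_mem {t : ℤ} (x : FreeU k m n) {f : (Fin (m + n) → ℤ) → k}
    (hf : f ∈ wtSpace q m n t) : freeRep q m n x f ∈ wtSpace q m n t := by
  induction x using FreeAlgebra.induction generalizing f with
  | grade0 c => rw [AlgHom.commutes]; exact Submodule.smul_mem _ c hf
  | grade1 g =>
    rw [freeRep, FreeAlgebra.lift_ι_apply]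
    cases g with
    | E j => exact opE_mem hf
    | F j => exact opF_mem hf
    | K i => intro a ha; simp [genOp, shiftOp_apply, hf a ha]
    | Kinv i => intro a ha; simp [genOp, shiftOp_apply, hf a ha]
    | sigma => intro a ha; simp [genOp, shiftOp_apply, hf a ha]
  | mul x y hx hy => rw [map_mul]; exact hx (hy hf)
  | add x y hx hy => rw [map_add]; exact Submodule.add_mem _ (hx hf) (hy hf)

/-! ### Verification of the relations -/

theorem diag_mul_opE (χ : (Fin (m + n) → ℤ) → k) (j : Fin (m + n - 1)) (c : k)
    (h : ∀ a, χ a = c * χ (a - root j)) :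
    shiftOp χ 0 * opE q m n j = c • (opE q m n j * shiftOp χ 0) := by
  ext f a
  simp only [Module.End.mul_apply, LinearMap.smul_apply, Pi.smul_apply, smul_eq_mul, opE_apply,
    shiftOp_apply, sub_zero]
  rw [h a]; ring

theorem diag_mul_opF (χ : (Fin (m + n) → ℤ) → k) (j : Fin (m + n - 1)) (c : k)
    (h : ∀ a, χ a = c * χ (a + root j)) :
    shiftOp χ 0 * opF q m n j = c • (opF q m n j * shiftOp χ 0) := by
  ext f a
  simp only [Module.End.mul_apply, LinearMap.smul_apply, Pi.smul_apply, smul_eq_mul, opF_apply,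
    shiftOp_apply, sub_zero]
  rw [h a]; ring

theorem qi_ne_zero (hq0 : q ≠ 0) (i : ℕ) : qi q m i ≠ 0 := by
  unfold qi; split_ifs
  · exact hq0
  · exact inv_ne_zero hq0

theorem oddDeg_add (a b : Fin (m + n) → ℤ) : oddDeg m n (a + b) = oddDeg m n a + oddDeg m n b := by
  rw [oddDeg, oddDeg, oddDeg, ← Finset.sum_add_distrib]
  refine Finset.sum_congr rfl fun i _ => ?_
  split_ifs <;> simp

theorem oddDeg_single (i : Fin (m + n)) (z : ℤ) :
    oddDeg m n (Pi.single i z) = if m ≤ i.1 then z else 0 := by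
  rw [oddDeg, Finset.sum_eq_single i]
  · simp
  · intro b _ hb; simp [Pi.single_eq_of_ne hb]
  · simp

theorem oddDeg_root (j : Fin (m + n - 1)) : oddDeg m n (root j) = -(par m j : ℤ) := by
  rw [root, sub_eq_add_neg, ← Pi.single_neg, oddDeg_add, oddDeg_single, oddDeg_single]
  simp only [lo, hi, par]
  push_cast
  split_ifs <;> omega

theorem sign_mul_self (x : ℤ) : ((-1 : k) ^ x) * (-1) ^ x = 1 := by
  rw [← mul_zpow]; simp

theorem opE_commute_opF {i j : Fin (m + n - 1)} (hij : i ≠ j) :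
    Commute (opE q m n i) (opF q m n j) := by
  have h : i.1 ≠ j.1 := fun h => hij (Fin.ext h)
  exact (raise_commute.mul_right (raise_commute_lower (by simpa [lo] using h))).mul_left
    ((lower_commute_raise (by simpa [hi] using h)).mul_right lower_commute)

/-- The two sides are the coefficients of the relation between `E_j` and `F_j` on a monomial with
exponents `x`, `y` in the variables `j`, `j + 1`. Admissibility is essential, as exterior exponents
must be `0` or `1` and divided power exponents nonnegative. -/
theorem coeff_comm_eq (hq0 : q ≠ 0) (hq1 : q ^ 2 ≠ 1) (j : ℕ) (x y : ℤ)
    (hx : x ∈ adm q m j) (hy : y ∈ adm q m (j + 1)) :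
    raiseCoeff q m j x * lowerCoeff k m (j + 1) y *
        (raiseCoeff q m (j + 1) (y + 1) * lowerCoeff k m j (x - 1)) -
      (-1) ^ (par m j * par m j) * (raiseCoeff q m (j + 1) y * lowerCoeff k m j x *
        (raiseCoeff q m j (x + 1) * lowerCoeff k m (j + 1) (y - 1))) =
    (qi q m j - (qi q m j)⁻¹)⁻¹ * (qi q m j ^ x * qi q m (j + 1) ^ (-y) -
      qi q m (j + 1) ^ y * qi q m j ^ (-x)) := by
  have hs := sub_inv_ne_zero hq0 hq1
  obtain ⟨hx0, hx1⟩ := hx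
  obtain ⟨hy0, hy1⟩ := hy
  simp only [raiseCoeff, lowerCoeff, qi, par] at hx1 hy1 ⊢
  -- Two exterior variables, or the odd root joining an exterior and a divided power variable, or
  -- two divided power variables.
  rcases lt_trichotomy (j + 1) m with h | h | h
  · rw [if_pos (by omega)] at hx1 hy1
    have h1 : j < m := by omega
    have h2 : j + 1 ≠ m := by omega
    obtain rfl | rfl : x = 0 ∨ x = 1 := by omega
    all_goals obtain rfl | rfl : y = 0 ∨ y = 1 := by omega
    all_goals simp [h, h1, h2]
    · rw [inv_mul_eq_div, eq_div_iff hs]; ring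
    · rw [inv_mul_cancel₀ hs]
  · have h1 : j < m := by omega
    have h2 : ¬ j + 1 < m := by omega
    rw [if_pos h1] at hx1
    obtain rfl | rfl : x = 0 ∨ x = 1 := by omega
    · rcases hy0.lt_or_eq with h0 | rfl
      · have : 1 ≤ y := by omega
        simp [h, h1, this, qZ, div_eq_inv_mul]
      · simp [h, h1]
    · simp only [h, h1, hy0]
      simp [qZ, div_eq_inv_mul, zpow_add₀ hq0, mul_comm]
  · have h1 : ¬ j < m := by omega
    have h2 : ¬ j + 1 < m := by omega
    have h3 : j + 1 ≠ m := by omega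
    -- The cut-off of the lowering operator can be dropped, since it only acts at exponent `0`,
    -- where the factor `[0]` vanishes already.
    have h4 : qZ q x * (if 0 ≤ x - 1 then 1 else 0) = qZ q x := by
      split_ifs with h
      · simp
      · rw [show x = 0 by omega]; simp
    have h5 : qZ q y * (if 0 ≤ y - 1 then 1 else 0) = qZ q y := by
      split_ifs with h
      · simp
      · rw [show y = 0 by omega]; simp
    simp only [h1, h2, h3, hx0, hy0, if_true, if_false]
    calc _ = (qZ q x * (if 0 ≤ x - 1 then 1 else 0)) * qZ q (y + 1) -
          (qZ q y * (if 0 ≤ y - 1 then 1 else 0)) * qZ q (x + 1) := by simp only [mul_zero, pow_zero]; ring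
      _ = qZ q (x - y) := by rw [h4, h5, qZ_mul_sub hq0 hq1]
      _ = _ := by
        rw [qZ, inv_inv, div_eq_inv_mul, ← neg_sub q q⁻¹, ← neg_inv, neg_mul, ← mul_neg, neg_sub]
        simp only [zpow_sub₀ hq0, neg_sub, inv_zpow', zpow_neg]
        congr 1
        field_simp

theorem opE_mul_opF_sub (hq0 : q ≠ 0) (hq1 : q ^ 2 ≠ 1) {t : ℤ} (j : Fin (m + n - 1))
    {f : (Fin (m + n) → ℤ) → k} (hf : f ∈ wtSpace q m n t) :
    (opE q m n j * opF q m n j) f - (-1 : k) ^ (par m j * par m j) •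
        (opF q m n j * opE q m n j) f =
      (qi q m j - (qi q m j)⁻¹)⁻¹ •
        ((shiftOp (fun a => qi q m (lo j) ^ a (lo j)) 0 *
            shiftOp (fun a => qi q m (hi j) ^ (-a (hi j))) 0) f -
          (shiftOp (fun a => qi q m (hi j) ^ a (hi j)) 0 *
            shiftOp (fun a => qi q m (lo j) ^ (-a (lo j))) 0) f) := by
  ext a
  simp only [Module.End.mul_apply, Pi.smul_apply, Pi.sub_apply, smul_eq_mul, opE_apply, opF_apply,
    shiftOp_apply, sub_zero, sub_add_cancel, add_sub_cancel_right, Pi.add_apply, root_lo, root_hi,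
    sub_neg_eq_add, ← sub_eq_add_neg]
  by_cases ha : a ∈ wtSet q m n t
  · have e1 : (lo j).1 = j.1 := rfl
    have e2 : (hi j).1 = j.1 + 1 := rfl
    rw [e1, e2]
    linear_combination
      f a * coeff_comm_eq hq0 hq1 j (a (lo j)) (a (hi j)) (ha.1 (lo j)) (ha.1 (hi j))
  · simp [hf a ha]

theorem serre3_opE (hq0 : q ≠ 0) (hq1 : q ^ 2 ≠ 1) (i j : Fin (m + n - 1))
    (hij : i.1 + 1 = j.1 ∨ j.1 + 1 = i.1) (hi : i.1 + 1 ≠ m) :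
    serre3 q (opE q m n i) (opE q m n j) = 0 := by
  rcases hij with hij | hij
  · have e : QuantumGrassmann.hi i = lo j := Fin.ext hij
    rw [opE, opE, e]
    refine serre3_mul_mul q (raise_commute_lower ?_) raise_commute (raise_commute_lower ?_)
      lower_commute ?_
    · simp only [ne_eq, Fin.ext_iff, lo]; omega
    · simp only [ne_eq, Fin.ext_iff, lo, QuantumGrassmann.hi]; omega
    -- As `i` is not the odd index, either both of its variables are exterior and the operator `p`
    -- squares to zero, or both are divided power variables and the cubic relation applies.
    · by_cases h : i.1 + 1 < m
      · rw [raise_mul_self (show (lo i).1 < m by simp only [lo]; omega)]; simp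
      · rw [lower_lower_raise hq0 (by simp only [lo]; omega)]; simp
  · have e : QuantumGrassmann.hi j = lo i := Fin.ext hij
    rw [opE, opE, e, (raise_commute_lower (lo_ne_hi i)).eq]
    rw [(raise_commute_lower (q := q) (show lo j ≠ lo i from ?_)).eq]
    · refine serre3_mul_mul q (lower_commute_raise (lo_ne_hi i).symm) lower_commute
        (lower_commute_raise ?_) raise_commute ?_
      · simp only [ne_eq, Fin.ext_iff, lo, QuantumGrassmann.hi]; omega
      · by_cases h : i.1 + 1 < m
        · rw [lower_mul_self (show (QuantumGrassmann.hi i).1 < m from h)]; simp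
        · rw [raise_raise_lower hq0 hq1 (by simp only [lo]; omega)]; simp
    · simp only [ne_eq, Fin.ext_iff, lo]; omega

theorem serre3_opF (hq0 : q ≠ 0) (hq1 : q ^ 2 ≠ 1) (i j : Fin (m + n - 1))
    (hij : i.1 + 1 = j.1 ∨ j.1 + 1 = i.1) (hi : i.1 + 1 ≠ m) :
    serre3 q (opF q m n i) (opF q m n j) = 0 := by
  rcases hij with hij | hij
  · have e : QuantumGrassmann.hi i = lo j := Fin.ext hij
    rw [opF, opF, e, (raise_commute_lower (q := q) (show lo j ≠ lo i from ?_)).eq,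
      (raise_commute_lower (lo_ne_hi j).symm).eq]
    · refine serre3_mul_mul q (lower_commute_raise ?_) lower_commute (lower_commute_raise ?_)
        raise_commute ?_
      · simp only [ne_eq, Fin.ext_iff, lo]; omega
      · simp only [ne_eq, Fin.ext_iff, lo, QuantumGrassmann.hi]; omega
      · by_cases h : i.1 + 1 < m
        · rw [lower_mul_self (show (lo i).1 < m by simp only [lo]; omega)]; simp
        · rw [raise_raise_lower hq0 hq1 (by simp only [lo]; omega)]; simp
    · simp only [ne_eq, Fin.ext_iff, lo]; omega
  · have e : QuantumGrassmann.hi j = lo i := Fin.ext hij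
    rw [opF, opF, e]
    refine serre3_mul_mul q (raise_commute_lower (lo_ne_hi i).symm) raise_commute
      (raise_commute_lower ?_) lower_commute ?_
    · simp only [ne_eq, Fin.ext_iff, lo, QuantumGrassmann.hi]; omega
    · by_cases h : i.1 + 1 < m
      · rw [raise_mul_self (show (QuantumGrassmann.hi i).1 < m from h)]; simp
      · rw [lower_lower_raise hq0 (by simp only [lo]; omega)]; simp

theorem serre4_opE (hq0 : q ≠ 0) (a b c : Fin (m + n - 1)) (hb : b.1 + 1 = m)
    (ha : a.1 + 1 = b.1) (hc : b.1 + 1 = c.1) :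
    serre4 q (opE q m n a) (opE q m n b) (opE q m n c) = 0 := by
  have e1 : hi a = lo b := Fin.ext ha
  have e2 : hi b = lo c := Fin.ext hc
  rw [opE, opE, opE, e1, e2]
  refine serre4_mul_mul q raise_commute (raise_commute_lower ?_) raise_commute
    (raise_commute_lower ?_) (lower_commute_raise ?_) lower_commute raise_commute
    (raise_commute_lower ?_) (lower_commute_raise ?_) lower_commute lower_commute
    (raise_mul_self (show (lo b).1 < m by simp only [lo]; omega))
    (lower_lower_raise hq0 (by simp only [lo]; omega))
  all_goals simp only [ne_eq, Fin.ext_iff, lo, hi]; omega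

theorem serre4_opF (hq0 : q ≠ 0) (hq1 : q ^ 2 ≠ 1) (a b c : Fin (m + n - 1)) (hb : b.1 + 1 = m)
    (ha : a.1 + 1 = b.1) (hc : b.1 + 1 = c.1) :
    serre4 q (opF q m n a) (opF q m n b) (opF q m n c) = 0 := by
  have e1 : hi a = lo b := Fin.ext ha
  have e2 : hi b = lo c := Fin.ext hc
  rw [opF, opF, opF, e1, e2, (raise_commute_lower (q := q) (show lo b ≠ lo a from ?_)).eq,
    (raise_commute_lower (q := q) (show lo c ≠ lo b from ?_)).eq,
    (raise_commute_lower (q := q) (lo_ne_hi c).symm).eq]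
  · refine serre4_mul_mul q lower_commute (lower_commute_raise ?_) lower_commute
      (lower_commute_raise ?_) (raise_commute_lower ?_) raise_commute lower_commute
      (lower_commute_raise ?_) (raise_commute_lower ?_) raise_commute raise_commute
      (lower_mul_self (show (lo b).1 < m by simp only [lo]; omega))
      (raise_raise_lower hq0 hq1 (by simp only [lo]; omega))
    all_goals simp only [ne_eq, Fin.ext_iff, lo, hi]; omega
  all_goals simp only [ne_eq, Fin.ext_iff, lo]; omega

theorem opE_mul_self {j : Fin (m + n - 1)} (hj : j.1 + 1 = m) :
    opE q m n j * opE q m n j = 0 := by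
  have h : (lo j).1 < m := by simp only [lo]; omega
  rw [opE, (lower_commute_raise (lo_ne_hi j).symm).mul_mul_mul_comm, raise_mul_self h, zero_mul]

theorem opF_mul_self {j : Fin (m + n - 1)} (hj : j.1 + 1 = m) :
    opF q m n j * opF q m n j = 0 := by
  have h : (lo j).1 < m := by simp only [lo]; omega
  rw [opF, (lower_commute_raise (lo_ne_hi j)).mul_mul_mul_comm, lower_mul_self h, mul_zero]

/-- Only the relation between `E_j` and `F_j` for equal indices needs the support condition on `f`;
all other relations hold on arbitrary functions. -/
theorem freeRep_eq_of_rel (hq0 : q ≠ 0) (hq1 : q ^ 2 ≠ 1) {t : ℤ} {x y : FreeU k m n}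
    (h : URel q m n x y) {f : (Fin (m + n) → ℤ) → k} (hf : f ∈ wtSpace q m n t) :
    freeRep q m n x f = freeRep q m n y f := by
  have hE : ∀ j, freeRep q m n (fE k j) = opE q m n j := fun j => FreeAlgebra.lift_ι_apply _ _
  have hF : ∀ j, freeRep q m n (fF k j) = opF q m n j := fun j => FreeAlgebra.lift_ι_apply _ _
  have hK : ∀ i, freeRep q m n (fK k i) = shiftOp (fun a => qi q m i ^ a i) 0 :=
    fun j => FreeAlgebra.lift_ι_apply _ _
  have hKi : ∀ i, freeRep q m n (fKinv k i) = shiftOp (fun a => qi q m i ^ (-a i)) 0 :=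
    fun j => FreeAlgebra.lift_ι_apply _ _
  have hS : freeRep q m n (fS k) = shiftOp (fun a => (-1) ^ oddDeg m n a) 0 :=
    FreeAlgebra.lift_ι_apply _ _
  have hqi : ∀ i, qi q m i ≠ 0 := qi_ne_zero hq0
  have hSS : ∀ g : (Fin (m + n) → ℤ) → k, shiftOp (fun a => (-1 : k) ^ oddDeg m n a) 0
      (shiftOp (fun a => (-1) ^ oddDeg m n a) 0 g) = g := fun g => by
    ext a
    simp only [shiftOp_apply, sub_zero, ← mul_assoc, sign_mul_self, one_mul]
  cases h with
  | KK i j =>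
    rw [map_mul, map_mul, hK, hK, shiftOp_mul, shiftOp_mul]
    simp only [sub_zero, mul_comm]
  | KKinv i =>
    ext a
    simp only [map_mul, map_one, hK, hKi, Module.End.mul_apply, shiftOp_apply, sub_zero,
      Module.End.one_apply, ← mul_assoc]
    rw [← zpow_add₀ (hqi i), add_neg_cancel, zpow_zero, one_mul]
  | KinvK i =>
    ext a
    simp only [map_mul, map_one, hK, hKi, Module.End.mul_apply, shiftOp_apply, sub_zero,
      Module.End.one_apply, ← mul_assoc]
    rw [← zpow_add₀ (hqi i), neg_add_cancel, zpow_zero, one_mul]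
  | KE i j =>
    rw [map_mul, map_smul, map_mul, hK, hE, diag_mul_opE]
    intro a
    rw [← zpow_add₀ (hqi i), Pi.sub_apply, root_apply]
    ring_nf
  | KF i j =>
    rw [map_mul, map_smul, map_mul, hK, hF, diag_mul_opF]
    intro a
    rw [← zpow_add₀ (hqi i), Pi.add_apply, root_apply]
    ring_nf
  | EF i j =>
    by_cases hij : i = j
    · subst hij
      rw [if_pos rfl]
      simp only [map_sub, map_smul, map_mul, hE, hF, hK, hKi, LinearMap.sub_apply,
        LinearMap.smul_apply]
      exact opE_mul_opF_sub hq0 hq1 i hf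
    -- There is a single odd index, so the sign is trivial for `i ≠ j`.
    · have hp : par m i * par m j = 0 := by
        have : i.1 ≠ j.1 := fun h => hij (Fin.ext h)
        unfold par
        split_ifs <;> omega
      rw [if_neg hij, hp, pow_zero, one_smul, map_sub, map_mul, map_mul, hE, hF,
        (opE_commute_opF hij).eq, sub_self, map_zero]
  | EE i j h =>
    rw [map_mul, map_mul, hE, hE, opE, opE, Commute.eq]
    exact (raise_commute.mul_right (raise_commute_lower (by simp [Fin.ext_iff, lo, hi]; omega))).mul_left
      ((lower_commute_raise (by simp [Fin.ext_iff, lo, hi]; omega)).mul_right lower_commute)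
  | FF i j h =>
    rw [map_mul, map_mul, hF, hF, opF, opF, Commute.eq]
    exact (raise_commute.mul_right (raise_commute_lower (by simp [Fin.ext_iff, lo, hi]; omega))).mul_left
      ((lower_commute_raise (by simp [Fin.ext_iff, lo, hi]; omega)).mul_right lower_commute)
  | serreE i j hij hi =>
    simpa [serre3, hE] using congrArg (fun o => o f) (serre3_opE hq0 hq1 i j hij hi)
  | serreF i j hij hi =>
    simpa [serre3, hF] using congrArg (fun o => o f) (serre3_opF hq0 hq1 i j hij hi)
  | oddE j hj => rw [map_mul, hE, opE_mul_self hj, map_zero]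
  | oddF j hj => rw [map_mul, hF, opF_mul_self hj, map_zero]
  | extraE a b c hb ha hc =>
    simpa [serre4, hE] using congrArg (fun o => o f) (serre4_opE hq0 a b c hb ha hc)
  | extraF a b c hb ha hc =>
    simpa [serre4, hF] using congrArg (fun o => o f) (serre4_opF hq0 hq1 a b c hb ha hc)
  | sigma_sq =>
    rw [map_mul, hS, map_one, Module.End.mul_apply, hSS]; rfl
  | sigmaE j =>
    rw [map_mul, map_mul, map_smul, hS, hE, diag_mul_opE _ j ((-1) ^ par m j)]
    · rw [smul_mul_assoc, LinearMap.smul_apply, LinearMap.smul_apply, Module.End.mul_apply,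
        Module.End.mul_apply, hSS]
    · intro a
      have h1 := oddDeg_add (a - root j) (root j)
      rw [sub_add_cancel, oddDeg_root] at h1
      rw [h1, zpow_add₀ (by simp), mul_comm, zpow_neg, zpow_natCast, ← inv_pow, inv_neg_one]
  | sigmaF j =>
    rw [map_mul, map_mul, map_smul, hS, hF, diag_mul_opF _ j ((-1) ^ par m j)]
    · rw [smul_mul_assoc, LinearMap.smul_apply, LinearMap.smul_apply, Module.End.mul_apply,
        Module.End.mul_apply, hSS]
    · intro a
      rw [oddDeg_add, oddDeg_root, zpow_add₀ (by simp), mul_comm, zpow_neg, zpow_natCast, ← inv_pow,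
        inv_neg_one, mul_assoc, ← mul_pow]
      simp
  | sigmaK i =>
    rw [map_mul, map_mul, hS, hK]
    ext a
    simp only [Module.End.mul_apply, shiftOp_apply, sub_zero]
    linear_combination (qi q m i ^ a i * f a) * sign_mul_self (k := k) (oddDeg m n a)

variable (q m n) in
/-- The action of the free algebra on the functions supported on the monomials of degree `t`. -/
def freeSubRep (t : ℤ) : FreeU k m n →ₐ[k] Module.End k (wtSpace q m n t) where
  toFun x := (freeRep q m n x).restrict fun _ hf => freeRep_mem x hf
  map_one' := by ext f a; simp
  map_mul' x y := by ext f a; simp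
  map_zero' := by ext f a; simp
  map_add' x y := by ext f a; simp
  commutes' c := by ext f a; simp [Algebra.algebraMap_eq_smul_one]

/-- The action of `𝒰_q(gl(m|n))` on the functions supported on the monomials of degree `t`. -/
def repGl (hq0 : q ≠ 0) (hq1 : q ^ 2 ≠ 1) (t : ℤ) :
    UGl q m n →ₐ[k] Module.End k (wtSpace q m n t) :=
  RingQuot.liftAlgHom k ⟨freeSubRep q m n t, fun _ _ h => by
    ext f : 2
    exact freeRep_eq_of_rel hq0 hq1 h f.2⟩

theorem coe_repGl_mk (hq0 : q ≠ 0) (hq1 : q ^ 2 ≠ 1) (t : ℤ) (x : FreeU k m n)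
    (f : wtSpace q m n t) :
    (repGl hq0 hq1 t (UGl.mk q m n x) f : (Fin (m + n) → ℤ) → k) = freeRep q m n x f := by
  rw [repGl, UGl.mk, RingQuot.liftAlgHom_mkAlgHom_apply]
  rfl

/-! ### The triangular structure of the quantum superalgebras -/

variable (q m n) in
/-- `K_i⁻¹ ∈ 𝒰_q(gl(m|n))`. -/
def UGl.Kinv (i : Fin (m + n)) : UGl q m n := UGl.mk q m n (fKinv k i)

theorem UGl.mk_eq_of_rel {x y : FreeU k m n} (h : URel q m n x y) :
    UGl.mk q m n x = UGl.mk q m n y := RingQuot.mkAlgHom_rel k h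

theorem UGl.K_mul_Kinv (i : Fin (m + n)) : UGl.K q m n i * UGl.Kinv q m n i = 1 := by
  simpa [UGl.K, UGl.Kinv] using UGl.mk_eq_of_rel (URel.KKinv (q := q) i)

theorem UGl.Kinv_mul_K (i : Fin (m + n)) : UGl.Kinv q m n i * UGl.K q m n i = 1 := by
  simpa [UGl.K, UGl.Kinv] using UGl.mk_eq_of_rel (URel.KinvK (q := q) i)

theorem UGl.K_mul_F (hq0 : q ≠ 0) (i : Fin (m + n)) (j : Fin (m + n - 1)) :
    ∃ c : k, c ≠ 0 ∧ UGl.K q m n i * UGl.F q m n j = c • (UGl.F q m n j * UGl.K q m n i) :=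
  ⟨_, zpow_ne_zero _ (qi_ne_zero hq0 i),
    by simpa [UGl.K, UGl.F] using UGl.mk_eq_of_rel (URel.KF (q := q) i j)⟩

theorem UGl.Kinv_mul_F (hq0 : q ≠ 0) (i : Fin (m + n)) (j : Fin (m + n - 1)) :
    ∃ c : k, UGl.Kinv q m n i * UGl.F q m n j = c • (UGl.F q m n j * UGl.Kinv q m n i) := by
  obtain ⟨c, hc, h⟩ := UGl.K_mul_F hq0 i j
  refine ⟨c⁻¹, ?_⟩
  rw [eq_inv_smul_iff₀ hc]
  calc c • (UGl.Kinv q m n i * UGl.F q m n j)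
      = UGl.Kinv q m n i * (c • (UGl.F q m n j * UGl.K q m n i)) * UGl.Kinv q m n i := by
        rw [mul_smul_comm, smul_mul_assoc, mul_assoc, mul_assoc, UGl.K_mul_Kinv, mul_one]
    _ = UGl.F q m n j * UGl.Kinv q m n i := by
        rw [← h, ← mul_assoc, UGl.Kinv_mul_K, one_mul]

theorem UGl.S_mul_F (j : Fin (m + n - 1)) :
    ∃ c : k, UGl.S q m n * UGl.F q m n j = c • (UGl.F q m n j * UGl.S q m n) := by
  have h1 : UGl.S q m n * UGl.S q m n = 1 := by
    simpa [UGl.S] using UGl.mk_eq_of_rel (URel.sigma_sq (q := q) (m := m) (n := n))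
  have h2 : UGl.S q m n * UGl.F q m n j * UGl.S q m n = (-1 : k) ^ par m j • UGl.F q m n j := by
    simpa only [UGl.S, UGl.F, map_mul, map_smul] using UGl.mk_eq_of_rel (URel.sigmaF (q := q) j)
  refine ⟨(-1) ^ par m j, ?_⟩
  rw [← smul_mul_assoc, ← h2, mul_assoc, h1, mul_one]

/-- Expressing the toral term through `𝒦_j` and its inverse makes the identity usable for
`𝒰_q(sl(m|n))` too. -/
theorem UGl.E_mul_F (i j : Fin (m + n - 1)) :
    UGl.E q m n i * UGl.F q m n j =
      ((-1 : k) ^ (par m i * par m j)) • (UGl.F q m n j * UGl.E q m n i) +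
      (if i = j then (qi q m i - (qi q m i)⁻¹)⁻¹ •
        (UGl.calK q m n i - UGl.calKinv q m n i) else 0) := by
  have h := UGl.mk_eq_of_rel (URel.EF (q := q) i j)
  rw [map_sub, map_mul, map_smul, map_mul, sub_eq_iff_eq_add'] at h
  refine h.trans (congrArg _ ?_)
  split_ifs
  · rw [map_smul, map_sub]; rfl
  · rw [map_zero]

theorem UGl.calK_eq (j : Fin (m + n - 1)) :
    UGl.calK q m n j = UGl.K q m n (lo j) * UGl.Kinv q m n (hi j) := map_mul _ _ _

theorem UGl.calKinv_eq (j : Fin (m + n - 1)) :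
    UGl.calKinv q m n j = UGl.K q m n (hi j) * UGl.Kinv q m n (lo j) := map_mul _ _ _

theorem UGl.isTriangular (hq0 : q ≠ 0) : IsTriangular k (UGl.E q m n) (UGl.F q m n)
    (UGl.K q m n) (UGl.Kinv q m n) (UGl.S q m n) where
  adjoin_eq_top := by
    have h := congrArg (Subalgebra.map (UGl.mk q m n)) (FreeAlgebra.adjoin_range_ι k (Gen m n))
    rw [AlgHom.map_adjoin, Algebra.map_top,
      (AlgHom.range_eq_top (UGl.mk q m n)).2 (RingQuot.mkAlgHom_surjective k (URel q m n))] at h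
    rw [eq_top_iff, ← h]
    refine Algebra.adjoin_mono ?_
    rintro _ ⟨_, ⟨g, rfl⟩, rfl⟩
    cases g with
    | E j => exact .inl (.inl (.inl (.inl ⟨j, rfl⟩)))
    | F j => exact .inl (.inl (.inl (.inr ⟨j, rfl⟩)))
    | K i => exact .inl (.inl (.inr ⟨i, rfl⟩))
    | Kinv i => exact .inl (.inr ⟨i, rfl⟩)
    | sigma => exact .inr rfl
  inv_mul := UGl.Kinv_mul_K
  T_F i j := let ⟨c, _, h⟩ := UGl.K_mul_F hq0 i j; ⟨c, h⟩
  inv_F := UGl.Kinv_mul_F hq0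
  s_F := UGl.S_mul_F
  E_F i j := by
    refine ⟨_, _, ?_, UGl.E_mul_F i j⟩
    split_ifs
    · rw [UGl.calK_eq, UGl.calKinv_eq]
      have hK : ∀ i, UGl.K q m n i ∈ Algebra.adjoin k
          (Set.range (UGl.K q m n) ∪ Set.range (UGl.Kinv q m n)) :=
        fun i => Algebra.subset_adjoin (.inl ⟨i, rfl⟩)
      have hK' : ∀ i, UGl.Kinv q m n i ∈ Algebra.adjoin k
          (Set.range (UGl.K q m n) ∪ Set.range (UGl.Kinv q m n)) :=
        fun i => Algebra.subset_adjoin (.inr ⟨i, rfl⟩)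
      exact Subalgebra.smul_mem _ (Subalgebra.sub_mem _ (Subalgebra.mul_mem _ (hK _) (hK' _))
        (Subalgebra.mul_mem _ (hK _) (hK' _))) _
    · exact Subalgebra.zero_mem _

variable (q m n) in
/-- `𝒦_j⁻¹ ∈ 𝒰_q(sl(m|n))`. -/
def USl.calKinv (j : Fin (m + n - 1)) : USl q m n :=
  ⟨UGl.calKinv q m n j, Algebra.subset_adjoin (by simp)⟩

theorem K_mul_Kinv_mul_F (hq0 : q ≠ 0) (a b : Fin (m + n)) (j : Fin (m + n - 1)) :
    ∃ c : k, UGl.K q m n a * UGl.Kinv q m n b * UGl.F q m n j =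
      c • (UGl.F q m n j * (UGl.K q m n a * UGl.Kinv q m n b)) := by
  obtain ⟨c, -, hc⟩ := UGl.K_mul_F hq0 a j
  obtain ⟨d, hd⟩ := UGl.Kinv_mul_F hq0 b j
  refine ⟨d * c, ?_⟩
  rw [mul_assoc, hd, mul_smul_comm, ← mul_assoc, hc, smul_mul_assoc, smul_smul, mul_assoc]

theorem USl.isTriangular (hq0 : q ≠ 0) : IsTriangular k (USl.E q m n) (USl.F q m n)
    (USl.calK q m n) (USl.calKinv q m n) (USl.S q m n) where
  adjoin_eq_top := by
    -- Inside the larger algebra the claim becomes the definition of `USl`.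
    apply Subalgebra.map_injective (f := (USl q m n).val) Subtype.val_injective
    rw [AlgHom.map_adjoin, Algebra.map_top, Subalgebra.range_val]
    simp only [Set.image_union, Set.image_singleton, ← Set.range_comp]
    rfl
  inv_mul j := by
    apply Subtype.ext
    change UGl.calKinv q m n j * UGl.calK q m n j = 1
    rw [UGl.calK_eq, UGl.calKinv_eq, mul_assoc, ← mul_assoc (UGl.Kinv q m n (lo j)),
      UGl.Kinv_mul_K, one_mul, UGl.K_mul_Kinv]
  T_F i j := by
    obtain ⟨c, hc⟩ := K_mul_Kinv_mul_F hq0 (lo i) (hi i) j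
    rw [← UGl.calK_eq] at hc
    exact ⟨c, Subtype.ext hc⟩
  inv_F i j := by
    obtain ⟨c, hc⟩ := K_mul_Kinv_mul_F hq0 (hi i) (lo i) j
    rw [← UGl.calKinv_eq] at hc
    exact ⟨c, Subtype.ext hc⟩
  s_F j := by
    obtain ⟨c, hc⟩ := UGl.S_mul_F (q := q) j
    exact ⟨c, Subtype.ext hc⟩
  E_F i j := by
    refine ⟨(-1 : k) ^ (par m i * par m j), if i = j then (qi q m i - (qi q m i)⁻¹)⁻¹ •
        (USl.calK q m n i - USl.calKinv q m n i) else 0, ?_, ?_⟩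
    · split_ifs
      · exact Subalgebra.smul_mem _ (Subalgebra.sub_mem _
          (Algebra.subset_adjoin (.inl ⟨i, rfl⟩)) (Algebra.subset_adjoin (.inr ⟨i, rfl⟩))) _
      · exact Subalgebra.zero_mem _
    · apply Subtype.ext
      have h := UGl.E_mul_F (q := q) i j
      split_ifs at h ⊢
      · exact h
      · exact h

/-! ### Simplicity -/

theorem finite_wtSet (t : ℤ) : (wtSet q m n t).Finite := by
  refine (Set.finite_Icc (0 : Fin (m + n) → ℤ) fun _ => t).subset fun a ha => ⟨fun i => ?_, fun i => ?_⟩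
  · exact nonneg_of_mem_adm (ha.1 i)
  · rw [← ha.2]
    exact Finset.single_le_sum (fun j _ => nonneg_of_mem_adm (ha.1 j)) (Finset.mem_univ i)

/-- The functions supported on `S` are the functions on `S`. -/
def wtSpaceEquiv (t : ℤ) : wtSpace q m n t ≃ₗ[k] (wtSet q m n t → k) :=
  open Classical in
  { toFun f a := f.1 a
    map_add' _ _ := rfl
    map_smul' _ _ := rfl
    invFun g := ⟨fun a => if h : a ∈ wtSet q m n t then g ⟨a, h⟩ else 0, fun a ha => dif_neg ha⟩
    left_inv f := by
      ext a
      by_cases h : a ∈ wtSet q m n t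
      · simp [h]
      · simp [h, f.2 a h]
    right_inv g := by ext a; simp }

theorem rank_wtSpace (t : ℤ) : Module.rank k (wtSpace q m n t) = (wtSet q m n t).ncard := by
  have := (finite_wtSet (q := q) (m := m) (n := n) t).fintype
  rw [(wtSpaceEquiv t).rank_eq, rank_fun', Set.ncard_eq_toFinset_card', Set.toFinset_card]

variable (q m n) in
/-- The operator of `E_j` on the component of degree `t`. -/
def subE (t : ℤ) (j : Fin (m + n - 1)) : Module.End k (wtSpace q m n t) :=
  (opE q m n j).restrict fun _ hf => opE_mem hf

variable (q m n) in
/-- The operator of `F_j` on the component of degree `t`. -/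
def subF (t : ℤ) (j : Fin (m + n - 1)) : Module.End k (wtSpace q m n t) :=
  (opF q m n j).restrict fun _ hf => opF_mem hf

/-- The basis vector of the component of degree `t` with exponents `a`. -/
def wtSingle {t : ℤ} (a : wtSet q m n t) : wtSpace q m n t :=
  ⟨fun b => if b = a.1 then 1 else 0, fun b hb =>
    if_neg (show b ≠ a.1 from fun h => hb (h ▸ a.2))⟩

theorem wtSingle_self {t : ℤ} (a : wtSet q m n t) : (wtSingle a).1 a.1 = 1 := if_pos rfl

theorem wtSingle_of_ne {t : ℤ} {a : wtSet q m n t} {b : Fin (m + n) → ℤ} (h : b ≠ a.1) :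
    (wtSingle a).1 b = 0 := if_neg h

theorem eq_sum_wtSingle {t : ℤ} [Fintype (wtSet q m n t)] (f : wtSpace q m n t) :
    f = ∑ a, f.1 a.1 • wtSingle a := by
  ext b
  simp only [AddSubmonoidClass.coe_finsetSum, Submodule.coe_smul, Finset.sum_apply,
    Pi.smul_apply, smul_eq_mul]
  by_cases hb : b ∈ wtSet q m n t
  · rw [Finset.sum_eq_single ⟨b, hb⟩]
    · rw [wtSingle_self ⟨b, hb⟩, mul_one]
    · intro a _ ha
      rw [wtSingle_of_ne (fun h => ha (Subtype.ext h.symm)), mul_zero]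
    · simp
  · rw [f.2 b hb, Finset.sum_eq_zero]
    intro a _
    rw [wtSingle_of_ne (show b ≠ a.1 from fun h => hb (h ▸ a.2)), mul_zero]

/-- Lets one descend from an exponent to the next lower one without loss. -/
theorem subF_wtSingle {t : ℤ} {j : Fin (m + n - 1)} (b : wtSet q m n t)
    (hb : b.1 + root j ∈ wtSet q m n t) :
    ∃ c : k, c ≠ 0 ∧ subF q m n t j (wtSingle ⟨b.1 + root j, hb⟩) = c • wtSingle b := by
  refine ⟨_, (coeffF_ne_zero_iff hb).2 b.2, ?_⟩
  ext a
  simp only [subF, LinearMap.coe_restrict_apply, opF_apply, Submodule.coe_smul,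
    Pi.smul_apply, smul_eq_mul]
  by_cases h : a = b.1
  · rw [h, wtSingle_self b, show (wtSingle ⟨b.1 + root j, hb⟩).1 (b.1 + root j) = 1 from if_pos rfl]
  · rw [wtSingle_of_ne h, wtSingle_of_ne (fun h' => h (add_right_cancel h')), mul_zero, mul_zero]

/-- The height of a tuple of exponents. -/
def height (a : Fin (m + n) → ℤ) : ℤ := ∑ i, (i.1 : ℤ) * a i

/-- `E_j` lowers the height by one and `F_j` raises it by one. As heights of admissible exponents
are nonnegative, they are the induction parameter for simplicity. -/
theorem height_add_root (a : Fin (m + n) → ℤ) (j : Fin (m + n - 1)) :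
    height (a + root j) = height a - 1 := by
  have : ∑ i : Fin (m + n), (i.1 : ℤ) * root j i = -1 := by
    simp only [root_apply, mul_sub, mul_ite, mul_one, mul_zero, Finset.sum_sub_distrib,
      Finset.sum_ite_eq', Finset.mem_univ, if_true]
    simp [lo, hi]
  simp only [height, Pi.add_apply, mul_add, Finset.sum_add_distrib, this]
  ring

theorem height_nonneg {t : ℤ} {a : Fin (m + n) → ℤ} (ha : a ∈ wtSet q m n t) : 0 ≤ height a :=
  Finset.sum_nonneg fun i _ => mul_nonneg (by positivity) (nonneg_of_mem_adm (ha.1 i))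

/-- No simple root can be added to the exponents. -/
def IsHighest (q : k) (m n : ℕ) (t : ℤ) (a : Fin (m + n) → ℤ) : Prop :=
  a ∈ wtSet q m n t ∧ ∀ j, a + root j ∉ wtSet q m n t

theorem IsHighest.hi_eq_zero {t : ℤ} {a : Fin (m + n) → ℤ} (ha : IsHighest q m n t a)
    (j : Fin (m + n - 1)) (h : a (lo j) + 1 ∈ adm q m (lo j)) : a (hi j) = 0 := by
  by_contra h0
  have h1 := nonneg_of_mem_adm (ha.1.1 (hi j))
  refine ha.2 j ((mem_wtSet_iff_of_sub_root (j := j) (by simpa using ha.1)).2 ⟨by simpa using h, ?_⟩)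
  exact mem_adm_of_le (ha.1.1 (hi j)) (by simp; omega) (by simp)

/-- If the variable `p` has room left, the next exponent must be `0`, since otherwise a unit could
be moved to `p`. An exponent `0` has room again, so the vanishing propagates to the right. -/
theorem IsHighest.eq_zero_of_lt (hq0 : q ≠ 0) (hq1 : q ^ 2 ≠ 1) {t : ℤ} {a : Fin (m + n) → ℤ}
    (ha : IsHighest q m n t a) {p i : Fin (m + n)} (h : a p + 1 ∈ adm q m p) (hpi : p < i) :
    a i = 0 := by
  have key : ∀ d : ℕ, ∀ i : Fin (m + n), i.1 = p.1 + 1 + d → a i = 0 := by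
    intro d
    induction d with
    | zero =>
      intro i hi
      have := ha.hi_eq_zero ⟨p.1, by omega⟩ h
      rwa [show i = QuantumGrassmann.hi ⟨p.1, by omega⟩ from Fin.ext hi]
    | succ d ih =>
      intro i hi
      have h1 := ih ⟨p.1 + 1 + d, by omega⟩ rfl
      have := ha.hi_eq_zero ⟨p.1 + 1 + d, by omega⟩ (by
        change a ⟨p.1 + 1 + d, by omega⟩ + 1 ∈ _
        rw [h1]; exact one_mem_adm hq0 hq1 _ _)
      rwa [show i = QuantumGrassmann.hi ⟨p.1 + 1 + d, by omega⟩ from Fin.ext hi]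
  exact key (i.1 - p.1 - 1) i (by omega)

/-- If `a p < b p`, then `a` has room at `p` because `b p` is admissible. So `a` vanishes beyond
`p`, and its total degree is smaller than that of `b`. -/
theorem IsHighest.not_apply_lt (hq0 : q ≠ 0) (hq1 : q ^ 2 ≠ 1) {t : ℤ} {a b : Fin (m + n) → ℤ}
    (ha : IsHighest q m n t a) (hb : b ∈ wtSet q m n t) {p : Fin (m + n)}
    (h : ∀ i < p, a i = b i) : ¬ a p < b p := by
  intro hlt
  have h1 : a p + 1 ∈ adm q m p :=
    mem_adm_of_le (hb.1 p) (by have := nonneg_of_mem_adm (ha.1.1 p); omega) hlt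
  have h2 : ∑ i, a i < ∑ i, b i := by
    refine Finset.sum_lt_sum (fun i _ => ?_) ⟨p, Finset.mem_univ _, hlt⟩
    rcases lt_trichotomy i p with hi | rfl | hi
    · exact (h i hi).le
    · exact hlt.le
    · rw [ha.eq_zero_of_lt hq0 hq1 h1 hi]
      exact nonneg_of_mem_adm (hb.1 i)
  rw [ha.1.2, hb.2] at h2
  exact lt_irrefl _ h2

/-- At the first index where two highest exponents differ, neither can be the smaller one. -/
theorem IsHighest.unique (hq0 : q ≠ 0) (hq1 : q ^ 2 ≠ 1) {t : ℤ} {a b : Fin (m + n) → ℤ}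
    (ha : IsHighest q m n t a) (hb : IsHighest q m n t b) : a = b := by
  have key : ∀ d : ℕ, ∀ i : Fin (m + n), i.1 < d → a i = b i := by
    intro d
    induction d with
    | zero => intro i hi; omega
    | succ d ih =>
      intro i hi
      have h : ∀ j < i, a j = b j := fun j hj => ih j (by have : j.1 < i.1 := hj; omega)
      exact le_antisymm (not_lt.1 (hb.not_apply_lt hq0 hq1 ha.1 fun j hj => (h j hj).symm))
        (not_lt.1 (ha.not_apply_lt hq0 hq1 hb.1 h))
  ext i
  exact key _ i i.2

/-- Applying the `E_j` as long as some result is nonzero must stop, because the heights in the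
support drop. A nonzero vector killed by all `E_j` is a multiple of the highest basis vector. -/
theorem wtSingle_mem_of_ne_bot (hq0 : q ≠ 0) (hq1 : q ^ 2 ≠ 1) {t : ℤ} {a : Fin (m + n) → ℤ}
    (ha : IsHighest q m n t a) {U : Submodule k (wtSpace q m n t)} (hU : U ≠ ⊥)
    (hE : ∀ j, ∀ f ∈ U, subE q m n t j f ∈ U) : wtSingle ⟨a, ha.1⟩ ∈ U := by
  have key : ∀ N : ℕ, ∀ f ∈ U, f ≠ 0 → (∀ b, f.1 b ≠ 0 → height b < N) →
      wtSingle ⟨a, ha.1⟩ ∈ U := by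
    intro N
    induction N with
    | zero =>
      intro f _ hf0 hN
      refine absurd (Subtype.ext (funext fun b => ?_)) hf0
      by_contra hb
      have hbS : b ∈ wtSet q m n t := by by_contra h; exact hb (f.2 b h)
      have := height_nonneg hbS
      have := hN b hb
      omega
    | succ N ih =>
      intro f hf hf0 hN
      by_cases h : ∃ j, subE q m n t j f ≠ 0
      · obtain ⟨j, hj⟩ := h
        refine ih _ (hE j f hf) hj fun b hb => ?_
        rw [subE, LinearMap.coe_restrict_apply, opE_apply] at hb
        have h1 := hN _ (right_ne_zero_of_mul hb)
        have h2 := height_add_root (b - root j) j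
        rw [sub_add_cancel] at h2
        push_cast at h1
        omega
      · push Not at h
        -- The value of `E_j f` at `b + root j` involves `f` at `b` alone, so nothing can cancel:
        -- every exponent in the support of `f` is highest, hence equal to `a`.
        have hfb : ∀ b, b ≠ a → f.1 b = 0 := by
          intro b hba
          by_contra hb
          have hbS : b ∈ wtSet q m n t := by by_contra h; exact hb (f.2 b h)
          refine hba (IsHighest.unique hq0 hq1 ⟨hbS, fun j hj => ?_⟩ ha)
          have h1 := congrFun (congrArg Subtype.val (h j)) (b + root j)
          rw [subE, LinearMap.coe_restrict_apply, opE_apply, add_sub_cancel_right] at h1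
          exact mul_ne_zero ((coeffE_ne_zero_iff (by simpa using hbS)).2 hj) hb h1
        have hfa : f = f.1 a • wtSingle ⟨a, ha.1⟩ := by
          ext b
          by_cases hb : b = a
          · subst hb; simp [wtSingle]
          · simp [wtSingle, hfb b hb, hb]
        have hfa0 : f.1 a ≠ 0 := fun h0 => hf0 (by rw [hfa, h0, zero_smul])
        rw [← U.smul_mem_iff hfa0, ← hfa]
        exact hf
  obtain ⟨f, hf, hf0⟩ := U.exists_mem_ne_zero_of_ne_bot hU
  obtain ⟨B, hB⟩ := ((finite_wtSet (q := q) (m := m) (n := n) t).image height).bddAbove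
  refine key (B.toNat + 1) f hf hf0 fun b hb => ?_
  have hbS : b ∈ wtSet q m n t := by by_contra h; exact hb (f.2 b h)
  have := hB ⟨b, hbS, rfl⟩
  push_cast
  omega

/-- Induction on the height: an exponent other than `a` is not highest, so its basis vector is, up
to a nonzero scalar, the image under some `F_j` of one of smaller height. -/
theorem eq_top_of_wtSingle_mem (hq0 : q ≠ 0) (hq1 : q ^ 2 ≠ 1) {t : ℤ} {a : Fin (m + n) → ℤ}
    (ha : IsHighest q m n t a) {U : Submodule k (wtSpace q m n t)}
    (hF : ∀ j, ∀ f ∈ U, subF q m n t j f ∈ U) (hU : wtSingle ⟨a, ha.1⟩ ∈ U) : U = ⊤ := by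
  have key : ∀ N : ℕ, ∀ b : wtSet q m n t, height b.1 < N → wtSingle b ∈ U := by
    intro N
    induction N with
    | zero =>
      intro b hb
      have := height_nonneg b.2
      omega
    | succ N ih =>
      intro b hb
      by_cases hba : IsHighest q m n t b.1
      · rwa [show b = ⟨a, ha.1⟩ from Subtype.ext (hba.unique hq0 hq1 ha)]
      · rw [IsHighest, not_and, not_forall] at hba
        obtain ⟨j, hj⟩ := hba b.2
        rw [not_not] at hj
        obtain ⟨c, hc, h⟩ := subF_wtSingle b hj
        rw [← U.smul_mem_iff hc, ← h]
        refine hF j _ (ih _ ?_)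
        rw [height_add_root]
        push_cast at hb
        omega
  rw [eq_top_iff]
  rintro f -
  have := (finite_wtSet (q := q) (m := m) (n := n) t).fintype
  rw [eq_sum_wtSingle f]
  refine Submodule.sum_mem _ fun b _ => U.smul_mem _ (key ((height b.1).toNat + 1) b ?_)
  push_cast
  omega

/-- An algebra with a triangular structure which acts on the component of degree `t` through the
operators of `E_j` and `F_j` and diagonal operators has this component as a simple highest weight
module. -/
theorem IsTriangular.simpleOfDim_wtSpace {A : Type u} [Ring A] [Algebra k A] {I : Type}
    {E F : Fin (m + n - 1) → A} {T T' : I → A} {s : A} (h : IsTriangular k E F T T' s)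
    (hq0 : q ≠ 0) (hq1 : q ^ 2 ≠ 1) {t : ℤ} {a : Fin (m + n) → ℤ} (ha : IsHighest q m n t a)
    (ρ : A →ₐ[k] Module.End k (wtSpace q m n t)) (hE : ∀ j, ρ (E j) = subE q m n t j)
    (hF : ∀ j, ρ (F j) = subF q m n t j) (χ : (Fin (m + n) → ℤ) → I → k)
    (ε : (Fin (m + n) → ℤ) → k) (hT : ∀ i f b, (ρ (T i) f).1 b = χ b i * f.1 b)
    (hs : ∀ f b, (ρ s f).1 b = ε b * f.1 b) {d : ℕ} (hd : (wtSet q m n t).ncard = d) :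
    SimpleOfDim k A (SimpleQuot E F T s (χ a) (ε a)) d := by
  refine h.simpleOfDim ρ (wtSingle ⟨a, ha.1⟩) (fun j => ?_) (fun i => ?_) ?_ ?_ ?_
    (by rw [rank_wtSpace, hd])
  · rw [hE]
    ext b
    by_cases hb : b ∈ wtSet q m n t
    · rw [subE, LinearMap.coe_restrict_apply, opE_apply, wtSingle_of_ne, mul_zero]
      · rfl
      · intro h1
        refine ha.2 j ?_
        rw [← show b - root j = a from h1, sub_add_cancel]
        exact hb
    · exact (subE q m n t j _).2 b hb
  · ext b
    rw [hT]
    by_cases hb : b = a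
    · subst hb; simp
    · simp [wtSingle, hb]
  · ext b
    rw [hs]
    by_cases hb : b = a
    · subst hb; simp
    · simp [wtSingle, hb]
  · intro hmem
    -- The value of `F_j f` at `a` is a multiple of `f (a + root j)`, which is zero because `a` is
    -- highest. So the `F_j` never reach the coefficient at `a`.
    have hle : ⨆ j, LinearMap.range (ρ (F j)) ≤
        LinearMap.ker ((LinearMap.proj a).comp (wtSpace q m n t).subtype) := by
      refine iSup_le fun j => ?_
      rintro _ ⟨f, rfl⟩
      rw [hF, LinearMap.mem_ker]
      change (subF q m n t j f).1 a = 0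
      rw [subF, LinearMap.coe_restrict_apply, opF_apply, f.2 _ (ha.2 j), mul_zero]
    have := hle hmem
    rw [LinearMap.mem_ker] at this
    simp [wtSingle] at this
  · intro U hU hUE hUF
    refine eq_top_of_wtSingle_mem hq0 hq1 ha (fun j f hf => ?_)
      (wtSingle_mem_of_ne_bot hq0 hq1 ha hU fun j f hf => ?_)
    · rw [← hF]; exact hUF j f hf
    · rw [← hE]; exact hUE j f hf

/-! ### The highest weight modules of the quantum superalgebras -/

theorem coe_repGl_K (hq0 : q ≠ 0) (hq1 : q ^ 2 ≠ 1) {t : ℤ} (i : Fin (m + n))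
    (f : wtSpace q m n t) (b : Fin (m + n) → ℤ) :
    (repGl hq0 hq1 t (UGl.K q m n i) f).1 b = chiK q b i * f.1 b := by
  rw [UGl.K, coe_repGl_mk, freeRep, fK, FreeAlgebra.lift_ι_apply, genOp, shiftOp_apply, sub_zero]
  rfl

theorem coe_repGl_Kinv (hq0 : q ≠ 0) (hq1 : q ^ 2 ≠ 1) {t : ℤ} (i : Fin (m + n))
    (f : wtSpace q m n t) (b : Fin (m + n) → ℤ) :
    (repGl hq0 hq1 t (UGl.Kinv q m n i) f).1 b = (chiK q b i)⁻¹ * f.1 b := by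
  rw [UGl.Kinv, coe_repGl_mk, freeRep, fKinv, FreeAlgebra.lift_ι_apply, genOp, shiftOp_apply,
    sub_zero, zpow_neg]
  rfl

theorem coe_repGl_S (hq0 : q ≠ 0) (hq1 : q ^ 2 ≠ 1) {t : ℤ}
    (f : wtSpace q m n t) (b : Fin (m + n) → ℤ) :
    (repGl hq0 hq1 t (UGl.S q m n) f).1 b = chiS k b * f.1 b := by
  rw [UGl.S, coe_repGl_mk, freeRep, fS, FreeAlgebra.lift_ι_apply, genOp, shiftOp_apply, sub_zero]
  rfl

theorem coe_repGl_calK (hq0 : q ≠ 0) (hq1 : q ^ 2 ≠ 1) {t : ℤ} (j : Fin (m + n - 1))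
    (f : wtSpace q m n t) (b : Fin (m + n) → ℤ) :
    (repGl hq0 hq1 t (UGl.calK q m n j) f).1 b = chiCalK q b j * f.1 b := by
  rw [UGl.calK_eq, map_mul, Module.End.mul_apply, coe_repGl_K, coe_repGl_Kinv, chiCalK, mul_assoc]

theorem repGl_E (hq0 : q ≠ 0) (hq1 : q ^ 2 ≠ 1) {t : ℤ} (j : Fin (m + n - 1)) :
    repGl hq0 hq1 t (UGl.E q m n j) = subE q m n t j := by
  ext f : 2
  rw [UGl.E, coe_repGl_mk, freeRep, fE, FreeAlgebra.lift_ι_apply]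
  rfl

theorem repGl_F (hq0 : q ≠ 0) (hq1 : q ^ 2 ≠ 1) {t : ℤ} (j : Fin (m + n - 1)) :
    repGl hq0 hq1 t (UGl.F q m n j) = subF q m n t j := by
  ext f : 2
  rw [UGl.F, coe_repGl_mk, freeRep, fF, FreeAlgebra.lift_ι_apply]
  rfl

theorem simpleOfDim_VGl (hq0 : q ≠ 0) (hq1 : q ^ 2 ≠ 1) {t : ℤ} {a : Fin (m + n) → ℤ}
    (ha : IsHighest q m n t a) {d : ℕ} (hd : (wtSet q m n t).ncard = d) :
    SimpleOfDim k (UGl q m n) (VGl q a) d :=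
  (UGl.isTriangular hq0).simpleOfDim_wtSpace hq0 hq1 ha (repGl hq0 hq1 t) (repGl_E hq0 hq1)
    (repGl_F hq0 hq1) (chiK q) (chiS k) (coe_repGl_K hq0 hq1) (coe_repGl_S hq0 hq1) hd

theorem simpleOfDim_VSl (hq0 : q ≠ 0) (hq1 : q ^ 2 ≠ 1) {t : ℤ} {a : Fin (m + n) → ℤ}
    (ha : IsHighest q m n t a) {d : ℕ} (hd : (wtSet q m n t).ncard = d) :
    SimpleOfDim k (USl q m n) (VSl q a) d :=
  (USl.isTriangular hq0).simpleOfDim_wtSpace hq0 hq1 ha ((repGl hq0 hq1 t).comp (USl q m n).val)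
    (repGl_E hq0 hq1) (repGl_F hq0 hq1) (chiCalK q) (chiS k) (coe_repGl_calK hq0 hq1)
    (coe_repGl_S hq0 hq1) hd

/-! ### The restricted quotients -/

theorem pow_opE_apply (j : Fin (m + n - 1)) (p : ℕ) :
    ∃ c : (Fin (m + n) → ℤ) → k, ∀ f a, (opE q m n j ^ p) f a = c a * f (a - p • root j) := by
  induction p with
  | zero => exact ⟨fun _ => 1, fun f a => by simp⟩
  | succ p ih =>
    obtain ⟨c, hc⟩ := ih
    refine ⟨fun a => c a * (raiseCoeff q m (lo j) ((a - p • root j) (lo j)) *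
      lowerCoeff k m (hi j) ((a - p • root j) (hi j))), fun f a => ?_⟩
    rw [pow_succ, Module.End.mul_apply, hc, opE_apply, ← mul_assoc, sub_sub, succ_nsmul]

theorem pow_opF_apply (j : Fin (m + n - 1)) (p : ℕ) :
    ∃ c : (Fin (m + n) → ℤ) → k, ∀ f a, (opF q m n j ^ p) f a = c a * f (a + p • root j) := by
  induction p with
  | zero => exact ⟨fun _ => 1, fun f a => by simp⟩
  | succ p ih =>
    obtain ⟨c, hc⟩ := ih
    refine ⟨fun a => c a * (raiseCoeff q m (hi j) ((a + p • root j) (hi j)) *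
      lowerCoeff k m (lo j) ((a + p • root j) (lo j))), fun f a => ?_⟩
    rw [pow_succ, Module.End.mul_apply, hc, opF_apply, ← mul_assoc, add_assoc, succ_nsmul]

theorem coe_subE_pow {t : ℤ} (j : Fin (m + n - 1)) (p : ℕ) (f : wtSpace q m n t) :
    ((subE q m n t j ^ p) f).1 = (opE q m n j ^ p) f.1 := by
  induction p generalizing f with
  | zero => rfl
  | succ p ih => rw [pow_succ, pow_succ, Module.End.mul_apply, Module.End.mul_apply, ih]; rfl

theorem coe_subF_pow {t : ℤ} (j : Fin (m + n - 1)) (p : ℕ) (f : wtSpace q m n t) :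
    ((subF q m n t j ^ p) f).1 = (opF q m n j ^ p) f.1 := by
  induction p generalizing f with
  | zero => rfl
  | succ p ih => rw [pow_succ, pow_succ, Module.End.mul_apply, Module.End.mul_apply, ih]; rfl

/-- `E_j^p` relates the exponents `a - p • root j` and `a`. Both cannot be admissible, since the
entry of `a` at `lo j` is less than `p`. -/
theorem subE_pow_eq_zero {t : ℤ} (j : Fin (m + n - 1)) {p : ℕ}
    (hp : ∀ i x, x ∈ adm q m i → x < p) : subE q m n t j ^ p = 0 := by
  ext f a
  by_cases ha : a ∈ wtSet q m n t
  · obtain ⟨c, hc⟩ := pow_opE_apply (q := q) j p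
    rw [coe_subE_pow, hc, f.2, mul_zero]
    · rfl
    · intro h
      have h1 := nonneg_of_mem_adm (h.1 (lo j))
      have h2 := hp _ _ (ha.1 (lo j))
      simp at h1
      omega
  · exact ((subE q m n t j ^ p) f).2 a ha

theorem subF_pow_eq_zero {t : ℤ} (j : Fin (m + n - 1)) {p : ℕ}
    (hp : ∀ i x, x ∈ adm q m i → x < p) : subF q m n t j ^ p = 0 := by
  ext f a
  by_cases ha : a ∈ wtSet q m n t
  · obtain ⟨c, hc⟩ := pow_opF_apply (q := q) j p
    rw [coe_subF_pow, hc, f.2, mul_zero]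
    · rfl
    · intro h
      have h1 := nonneg_of_mem_adm (h.1 (hi j))
      have h2 := hp _ _ (ha.1 (hi j))
      simp at h1
      omega
  · exact ((subF q m n t j ^ p) f).2 a ha

/-- The action satisfies the restricted relations, so it factors through the quotient, and the
quotient inherits the triangular structure. Both are treated at once for `gl` and `sl`. -/
theorem IsTriangular.simpleOfDim_restr {A : Type u} [Ring A] [Algebra k A] {I : Type}
    {E F : Fin (m + n - 1) → A} {T T' : I → A} {s : A} (h : IsTriangular k E F T T' s)
    (hq0 : q ≠ 0) (hq1 : q ^ 2 ≠ 1) {t : ℤ} {a : Fin (m + n) → ℤ} (ha : IsHighest q m n t a)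
    (ρ : A →ₐ[k] Module.End k (wtSpace q m n t)) (hE : ∀ j, ρ (E j) = subE q m n t j)
    (hF : ∀ j, ρ (F j) = subF q m n t j) (χ : (Fin (m + n) → ℤ) → I → k)
    (ε : (Fin (m + n) → ℤ) → k) (hT : ∀ i f b, (ρ (T i) f).1 b = χ b i * f.1 b)
    (hs : ∀ f b, (ρ s f).1 b = ε b * f.1 b) {d : ℕ} (hd : (wtSet q m n t).ncard = d) {ℓ : ℕ}
    (hℓ : ∀ i x, x ∈ adm q m i → x < ℓ) (hχ : ∀ b i, χ b i ^ (2 * ℓ) = 1) :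
    SimpleOfDim k (Restr (fun j : Fin (m + n - 1) => j.1 + 1 = m) ℓ E F T)
      (SimpleQuot (A := Restr (fun j : Fin (m + n - 1) => j.1 + 1 = m) ℓ E F T)
        (fun j => RingQuot.mkAlgHom k _ (E j)) (fun j => RingQuot.mkAlgHom k _ (F j))
        (fun i => RingQuot.mkAlgHom k _ (T i)) (RingQuot.mkAlgHom k _ s) (χ a) (ε a)) d := by
  have hrel : ∀ ⦃x y⦄, RestrRel (fun j : Fin (m + n - 1) => j.1 + 1 = m) ℓ E F T x y →
      ρ x = ρ y := by
    intro x y hxy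
    cases hxy with
    | evenE j _ => rw [map_pow, hE, subE_pow_eq_zero j hℓ, map_zero]
    | evenF j _ => rw [map_pow, hF, subF_pow_eq_zero j hℓ, map_zero]
    | oddE j hj =>
      rw [map_pow, hE, map_zero]
      ext f : 2
      rw [coe_subE_pow, pow_two, opE_mul_self hj]; rfl
    | oddF j hj =>
      rw [map_pow, hF, map_zero]
      ext f : 2
      rw [coe_subF_pow, pow_two, opF_mul_self hj]; rfl
    | toral i =>
      have key : ∀ (p : ℕ) (f : wtSpace q m n t) (b : Fin (m + n) → ℤ),
          ((ρ (T i) ^ p) f).1 b = χ b i ^ p * f.1 b := by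
        intro p
        induction p with
        | zero => intro f b; simp
        | succ p ih =>
          intro f b
          rw [pow_succ, Module.End.mul_apply, ih, hT, pow_succ, mul_assoc]
      rw [map_pow, map_one]
      ext f b
      rw [key, hχ, one_mul]; rfl
  exact (h.map (RingQuot.mkAlgHom k _) (RingQuot.mkAlgHom_surjective k _)).simpleOfDim_wtSpace
    hq0 hq1 ha (RingQuot.liftAlgHom k ⟨ρ, hrel⟩)
    (fun j => by rw [RingQuot.liftAlgHom_mkAlgHom_apply, hE])
    (fun j => by rw [RingQuot.liftAlgHom_mkAlgHom_apply, hF]) χ ε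
    (fun i f b => by rw [RingQuot.liftAlgHom_mkAlgHom_apply, hT])
    (fun f b => by rw [RingQuot.liftAlgHom_mkAlgHom_apply, hs]) hd

theorem chiK_pow (hq : q ^ (2 * qChar q) = 1) (b : Fin (m + n) → ℤ) (i : Fin (m + n)) :
    chiK q b i ^ (2 * qChar q) = 1 := by
  have : qi q m i ^ (2 * qChar q) = 1 := by
    unfold qi; split_ifs
    · exact hq
    · rw [inv_pow, hq, inv_one]
  rw [chiK, ← zpow_natCast, ← zpow_mul, mul_comm, zpow_mul, zpow_natCast, this, one_zpow]

theorem simpleOfDim_vGl (hq0 : q ≠ 0) (hq1 : q ^ 2 ≠ 1) {t : ℤ} {a : Fin (m + n) → ℤ}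
    (ha : IsHighest q m n t a) {d : ℕ} (hd : (wtSet q m n t).ncard = d)
    (hℓ : ∀ i x, x ∈ adm q m i → x < qChar q) (hq : q ^ (2 * qChar q) = 1) :
    SimpleOfDim k (uGl q m n) (vGl q a) d :=
  (UGl.isTriangular hq0).simpleOfDim_restr hq0 hq1 ha (repGl hq0 hq1 t) (repGl_E hq0 hq1)
    (repGl_F hq0 hq1) (chiK q) (chiS k) (coe_repGl_K hq0 hq1) (coe_repGl_S hq0 hq1) hd hℓ
    (chiK_pow hq)

theorem simpleOfDim_vSl (hq0 : q ≠ 0) (hq1 : q ^ 2 ≠ 1) {t : ℤ} {a : Fin (m + n) → ℤ}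
    (ha : IsHighest q m n t a) {d : ℕ} (hd : (wtSet q m n t).ncard = d)
    (hℓ : ∀ i x, x ∈ adm q m i → x < qChar q) (hq : q ^ (2 * qChar q) = 1) :
    SimpleOfDim k (uSl q m n) (vSl q a) d :=
  (USl.isTriangular hq0).simpleOfDim_restr hq0 hq1 ha ((repGl hq0 hq1 t).comp (USl q m n).val)
    (repGl_E hq0 hq1) (repGl_F hq0 hq1) (chiCalK q) (chiS k) (coe_repGl_calK hq0 hq1)
    (coe_repGl_S hq0 hq1) hd hℓ fun b j => by
      rw [chiCalK, mul_pow, inv_pow, chiK_pow hq, chiK_pow hq, inv_one, one_mul]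

/-! ### The characteristic of `q` -/

/-- Multiplied by `q - q⁻¹`, the sum telescopes. -/
theorem qInt_eq_qZ (hq0 : q ≠ 0) (hq1 : q ^ 2 ≠ 1) (a : ℕ) : qInt q a = qZ q a := by
  rw [qZ, eq_div_iff (sub_inv_ne_zero hq0 hq1), qInt, Finset.sum_mul]
  have h := Finset.sum_range_sub' (fun i : ℕ => q ^ ((a : ℤ) - 2 * i)) a
  rw [Nat.cast_zero, mul_zero, sub_zero, show (a : ℤ) - 2 * a = -a by ring] at h
  rw [← h]
  refine Finset.sum_congr rfl fun i _ => ?_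
  rw [mul_sub, ← zpow_add_one₀ hq0, ← zpow_sub_one₀ hq0]
  congr 2
  · ring
  · push_cast; ring

theorem qInt_inv (a : ℕ) : qInt q⁻¹ a = qInt q a := by
  rw [qInt, qInt, ← Finset.sum_range_reflect]
  refine Finset.sum_congr rfl fun i hi => ?_
  rw [inv_zpow', Nat.sub_sub, Nat.cast_sub (by have := Finset.mem_range.1 hi; omega)]
  congr 1
  push_cast
  ring

/-- Needed because the divided power factor of `Ω_q^!` has the parameter `q⁻¹`, so that its
truncation is expressed through `qChar q⁻¹`. -/
theorem qChar_inv : qChar q⁻¹ = qChar q := by simp only [qChar, qInt_inv]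

theorem qZ_qChar (hq0 : q ≠ 0) (hq1 : q ^ 2 ≠ 1) (h : qChar q ≠ 0) : qZ q (qChar q) = 0 := by
  rw [← qInt_eq_qZ hq0 hq1]
  exact (Nat.sInf_mem (Nat.nonempty_of_pos_sInf (Nat.pos_of_ne_zero h))).2

theorem pow_two_mul_qChar (hq0 : q ≠ 0) (hq1 : q ^ 2 ≠ 1) (h : qChar q ≠ 0) :
    q ^ (2 * qChar q) = 1 := by
  have h1 := qZ_qChar hq0 hq1 h
  rw [qZ, div_eq_zero_iff, or_iff_left (sub_inv_ne_zero hq0 hq1), sub_eq_zero, zpow_neg,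
    zpow_natCast] at h1
  rw [two_mul, pow_add]
  nth_rewrite 2 [h1]
  exact mul_inv_cancel₀ (pow_ne_zero _ hq0)

theorem qZ_ne_zero (hq0 : q ≠ 0) (hq1 : q ^ 2 ≠ 1) {x : ℤ} (hx : 1 ≤ x)
    (h : qChar q = 0 ∨ x < qChar q) : qZ q x ≠ 0 := by
  intro h0
  lift x to ℕ using by omega
  rw [← qInt_eq_qZ hq0 hq1] at h0
  have hmem : x ∈ {ℓ : ℕ | 0 < ℓ ∧ qInt q ℓ = 0} := ⟨by omega, h0⟩
  rcases h with h | h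
  -- The infimum `0` means that `0` belongs to the set, which positivity excludes, or that the set
  -- is empty.
  · rcases Nat.sInf_eq_zero.1 h with h1 | h1
    · exact lt_irrefl _ h1.1
    · rw [h1] at hmem; exact hmem
  · have := Nat.sInf_le hmem
    rw [← qChar] at this
    omega

theorem mem_adm_of_lt {i : ℕ} (hi : i < m) {x : ℤ} : x ∈ adm q m i ↔ 0 ≤ x ∧ x ≤ 1 := by
  rw [adm, Set.mem_ofPred_eq, if_pos hi]

theorem mem_adm_generic (hq0 : q ≠ 0) (hq1 : q ^ 2 ≠ 1) (h : qChar q = 0) {i : ℕ} (hi : m ≤ i)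
    {x : ℤ} : x ∈ adm q m i ↔ 0 ≤ x := by
  rw [adm, Set.mem_ofPred_eq, if_neg (by omega), and_iff_left_iff_imp]
  exact fun _ y hy _ => qZ_ne_zero hq0 hq1 hy (.inl h)

theorem mem_adm_restricted (hq0 : q ≠ 0) (hq1 : q ^ 2 ≠ 1) (h : qChar q ≠ 0) {i : ℕ}
    (hi : m ≤ i) {x : ℤ} : x ∈ adm q m i ↔ 0 ≤ x ∧ x < qChar q := by
  rw [adm, Set.mem_ofPred_eq, if_neg (by omega)]
  refine and_congr_right fun hx => ⟨fun h1 => ?_, fun h1 y hy hyx =>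
    qZ_ne_zero hq0 hq1 hy (.inr (by omega))⟩
  by_contra h2
  exact h1 _ (by omega) (not_lt.1 h2) (qZ_qChar hq0 hq1 h)

/-! ### Linear independence of the monomials of `Λ_q(m)` -/

variable (q m) in
/-- The multiplication by `x_i`, in terms of coefficients. -/
def extOp (i : Fin m) : Module.End k (Finset (Fin m) → k) where
  toFun f μ := if i ∈ μ then (-q⁻¹) ^ (μ.filter (· < i)).card * f (μ.erase i) else 0
  map_add' f g := by ext μ; simp only [Pi.add_apply]; split_ifs <;> ring
  map_smul' c f := by
    ext μ; simp only [Pi.smul_apply, smul_eq_mul, RingHom.id_apply]; split_ifs <;> ring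

theorem extOp_apply (i : Fin m) (f : Finset (Fin m) → k) (μ : Finset (Fin m)) :
    extOp q m i f μ = if i ∈ μ then (-q⁻¹) ^ (μ.filter (· < i)).card * f (μ.erase i) else 0 := rfl

theorem extOp_mul_self (i : Fin m) : extOp q m i * extOp q m i = 0 := by
  ext f μ
  simp [extOp_apply]

/-- Removing `i` takes away one of the elements below `j`, whereas removing `j` does not affect
those below `i`. The difference is one factor `-q⁻¹`. -/
theorem extOp_mul_comm {i j : Fin m} (h : i < j) :
    extOp q m j * extOp q m i = (-q⁻¹) • (extOp q m i * extOp q m j) := by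
  refine LinearMap.ext fun f => funext fun μ => ?_
  simp only [Module.End.mul_apply, LinearMap.smul_apply, Pi.smul_apply, smul_eq_mul, extOp_apply,
    Finset.mem_erase]
  by_cases hi : i ∈ μ
  · by_cases hj : j ∈ μ
    · have h1 : (μ.erase j).filter (· < i) = μ.filter (· < i) := by
        ext x
        simp only [Finset.mem_filter, Finset.mem_erase]
        refine ⟨fun hx => ⟨hx.1.2, hx.2⟩, fun hx => ⟨⟨fun hxj => ?_, hx.1⟩, hx.2⟩⟩
        exact absurd (hxj ▸ hx.2) h.not_gt
      have h2 : (μ.filter (· < j)).card = ((μ.erase i).filter (· < j)).card + 1 := by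
        rw [Finset.filter_erase, Finset.card_erase_add_one]
        simp [hi, h]
      rw [if_pos hj, if_pos ⟨h.ne, hi⟩, if_pos hi, if_pos ⟨h.ne', hj⟩, h1, h2,
        Finset.erase_right_comm]
      ring
    · simp [hj]
  · simp [hi]

variable (q m) in
/-- The regular representation of `Λ_q(m)`, in terms of coefficients. -/
def extRep : QExt q m →ₐ[k] Module.End k (Finset (Fin m) → k) :=
  RingQuot.liftAlgHom k ⟨FreeAlgebra.lift k (extOp q m), fun x y h => by
    cases h with
    | sq i => rw [map_mul, FreeAlgebra.lift_ι_apply, extOp_mul_self, map_zero]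
    | anti i j h =>
      rw [map_mul, map_smul, map_mul, FreeAlgebra.lift_ι_apply, FreeAlgebra.lift_ι_apply,
        extOp_mul_comm h]⟩

theorem extRep_gen (i : Fin m) : extRep q m (QExt.gen q i) = extOp q m i := by
  rw [extRep, QExt.gen, RingQuot.liftAlgHom_mkAlgHom_apply, FreeAlgebra.lift_ι_apply]

/-- Multiplying an ordered monomial on the left by a smaller generator leaves it ordered, so no
scalar appears. -/
theorem extOp_single {i : Fin m} {ν : Finset (Fin m)} (h : ∀ j ∈ ν, i < j) :
    extOp q m i (fun μ => if μ = ν then 1 else 0) = fun μ => if μ = insert i ν then 1 else 0 := by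
  have hi : i ∉ ν := fun hi => lt_irrefl _ (h i hi)
  funext μ
  rw [extOp_apply]
  by_cases hμ : μ = insert i ν
  · subst hμ
    have : (insert i ν).filter (· < i) = ∅ := by
      rw [Finset.filter_eq_empty_iff]
      intro x hx
      rcases Finset.mem_insert.1 hx with rfl | hx
      · exact lt_irrefl _
      · exact (h x hx).not_gt
    simp [this, Finset.erase_insert hi]
  · rw [if_neg hμ]
    split_ifs with h1 h2
    · exact absurd (by rw [← h2, Finset.insert_erase h1]) hμ
    · rw [mul_zero]
    · rfl

theorem extRep_mono_empty (μ : Finset (Fin m)) :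
    extRep q m (QExt.mono q μ) (fun ν => if ν = ∅ then 1 else 0) =
      fun ν => if ν = μ then 1 else 0 := by
  have key : ∀ l : List (Fin m), l.Pairwise (· < ·) →
      extRep q m ((l.map (QExt.gen q)).prod) (fun ν => if ν = ∅ then 1 else 0) =
        fun ν => if ν = l.toFinset then 1 else 0 := by
    intro l hl
    induction l with
    | nil => funext ν; by_cases h : ν = ∅ <;> simp [h]
    | cons i l ih =>
      rw [List.pairwise_cons] at hl
      rw [List.map_cons, List.prod_cons, map_mul, Module.End.mul_apply, ih hl.2, extRep_gen,
        List.toFinset_cons, extOp_single]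
      intro j hj
      exact hl.1 j (List.mem_toFinset.1 hj)
  rw [QExt.mono, key _ (Finset.sortedLT_sort μ).pairwise, Finset.sort_toFinset]

/-- Evaluating the regular representation at the vector of the empty monomial maps the monomials to
the standard basis. -/
theorem linearIndependent_extMono :
    LinearIndependent k (fun μ : Finset (Fin m) => QExt.mono q μ) := by
  refine LinearIndependent.of_comp
    ((LinearMap.applyₗ (fun ν => if ν = ∅ then (1 : k) else 0)).comp (extRep q m).toLinearMap) ?_
  convert (Pi.basisFun k (Finset (Fin m))).linearIndependent using 1
  funext μ
  refine (extRep_mono_empty μ).trans ?_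
  funext ν
  simp [Pi.single_apply]

/-! ### The components of `Ω_q^!(m|n)` -/

open Classical in
/-- The exponents of total degree `s` with the property `P`. -/
def expSet (P : (Fin n → ℕ) → Prop) (s : ℕ) : Finset (Fin n → ℕ) :=
  (Finset.piAntidiag Finset.univ s).filter P

theorem mem_expSet {P : (Fin n → ℕ) → Prop} {s : ℕ} {β : Fin n → ℕ} :
    β ∈ expSet P s ↔ ∑ i, β i = s ∧ P β := by
  simp [expSet]

open Classical in
/-- The exponents of the monomials of degree `t` of `Ω_q^!(m|n)` with the property `P`. -/
def pairSet (m : ℕ) (P : (Fin n → ℕ) → Prop) (t : ℕ) : Finset (Finset (Fin m) × (Fin n → ℕ)) :=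
  (Finset.range (t + 1)).biUnion fun s =>
    Finset.powersetCard s Finset.univ ×ˢ expSet P (t - s)

theorem mem_pairSet {P : (Fin n → ℕ) → Prop} {t : ℕ} {x : Finset (Fin m) × (Fin n → ℕ)} :
    x ∈ pairSet m P t ↔ x.1.card + ∑ i, x.2 i = t ∧ P x.2 := by
  simp only [pairSet, Finset.mem_biUnion, Finset.mem_range, Finset.mem_product,
    Finset.mem_powersetCard_univ, mem_expSet]
  constructor
  · rintro ⟨s, hs, rfl, h, hP⟩
    exact ⟨by omega, hP⟩
  · rintro ⟨h, hP⟩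
    exact ⟨x.1.card, by omega, rfl, by omega, hP⟩

theorem card_pairSet (m : ℕ) (P : (Fin n → ℕ) → Prop) (t : ℕ) :
    (pairSet m P t).card =
      ∑ s ∈ Finset.range (t + 1), m.choose s * (expSet P (t - s)).card := by
  rw [pairSet, Finset.card_biUnion]
  · simp
  · intro s _ s' _ hne
    rw [Function.onFun_apply, Finset.disjoint_left]
    intro x hx hx'
    rw [Finset.mem_product, Finset.mem_powersetCard_univ] at hx hx'
    exact hne (hx.1.symm.trans hx'.1)

variable (q) in
/-- The span of the monomials `x^(β)` of degree `s` whose exponents have the property `P`. -/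
def DivPow.spanDeg (P : (Fin n → ℕ) → Prop) (s : ℕ) : Submodule k (DivPow q n) :=
  Submodule.span k (DivPow.mono q '' expSet P s)

theorem DivPow.deg_eq (s : ℕ) : DivPow.deg q n s = DivPow.spanDeg q (fun _ => True) s := by
  rw [DivPow.deg, DivPow.spanDeg]
  congr 1
  ext x
  simp only [Set.mem_ofPred_eq, Set.mem_image, SetLike.mem_coe, mem_expSet, and_true, eq_comm]

theorem DivPow.restrictedDeg_eq (s : ℕ) : DivPow.restrictedDeg q n s =
    DivPow.spanDeg q (fun β => ∀ i, β i ≤ qChar q - 1) s := by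
  rw [DivPow.restrictedDeg, DivPow.spanDeg]
  congr 1
  ext x
  simp only [Set.mem_ofPred_eq, Set.mem_image, SetLike.mem_coe, mem_expSet]
  constructor
  · rintro ⟨β, h1, h2, rfl⟩; exact ⟨β, ⟨h2, h1⟩, rfl⟩
  · rintro ⟨β, ⟨h2, h1⟩, rfl⟩; exact ⟨β, h1, h2, rfl⟩

theorem linearIndependent_divPowMono :
    LinearIndependent k (fun β : Fin n → ℕ => DivPow.mono q β) :=
  Finsupp.linearIndependent_single_one k (Fin n → ℕ)

theorem rank_span_image {ι V : Type*} [AddCommGroup V] [Module k V] {v : ι → V}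
    (hv : LinearIndependent k v) (s : Finset ι) :
    Module.rank k (Submodule.span k (v '' s)) = s.card := by
  classical
  have h : LinearIndepOn k id ((s.image v : Finset V) : Set V) := by
    rw [Finset.coe_image]
    exact (hv.linearIndepOn s).id_image
  rw [← Finset.coe_image, rank_span_set h]
  refine Cardinal.mk_coe_finset.trans ?_
  rw [Finset.card_image_of_injective _ hv.injective]

theorem finrank_spanDeg (P : (Fin n → ℕ) → Prop) (s : ℕ) :
    Module.finrank k (DivPow.spanDeg q P s) = (expSet P s).card :=
  Module.finrank_eq_of_rank_eq (rank_span_image (v := fun β => DivPow.mono q β)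
    linearIndependent_divPowMono (expSet P s))

theorem finite_spanDeg (P : (Fin n → ℕ) → Prop) (s : ℕ) :
    Module.Finite k (DivPow.spanDeg q P s) :=
  Module.Finite.span_of_finite k ((expSet P s).finite_toSet.image _)

theorem iSup_map₂_eq_span (P : (Fin n → ℕ) → Prop) (t : ℕ) :
    (⨆ p ∈ Finset.HasAntidiagonal.antidiagonal t,
      Submodule.map₂ (TensorProduct.mk k (QExt q m) (DivPow q⁻¹ n))
        (QExt.deg q m p.1) (DivPow.spanDeg q⁻¹ P p.2) : Submodule k (Omega q m n)) =
      Submodule.span k ((fun x : Finset (Fin m) × (Fin n → ℕ) =>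
        QExt.mono q x.1 ⊗ₜ[k] DivPow.mono q⁻¹ x.2) '' pairSet m P t) := by
  apply le_antisymm
  · refine iSup₂_le fun p hp => ?_
    rw [QExt.deg, DivPow.spanDeg, Submodule.map₂_span_span]
    refine Submodule.span_mono ?_
    rintro _ ⟨_, ⟨μ, hμ, rfl⟩, _, ⟨β, hβ, rfl⟩, rfl⟩
    rw [SetLike.mem_coe, mem_expSet] at hβ
    rw [Finset.HasAntidiagonal.mem_antidiagonal] at hp
    exact ⟨(μ, β), mem_pairSet.2 ⟨by rw [hμ, hβ.1, hp], hβ.2⟩, rfl⟩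
  · rw [Submodule.span_le]
    rintro _ ⟨x, hx, rfl⟩
    rw [SetLike.mem_coe, mem_pairSet] at hx
    refine Submodule.mem_iSup_of_mem (x.1.card, ∑ i, x.2 i) (Submodule.mem_iSup_of_mem
      (Finset.HasAntidiagonal.mem_antidiagonal.2 hx.1) (Submodule.apply_mem_map₂ _ ?_ ?_))
    · exact Submodule.subset_span ⟨x.1, rfl, rfl⟩
    · exact Submodule.subset_span ⟨x.2, mem_expSet.2 ⟨rfl, hx.2⟩, rfl⟩

theorem rank_iSup_map₂ (P : (Fin n → ℕ) → Prop) (t : ℕ) :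
    Module.rank k (⨆ p ∈ Finset.HasAntidiagonal.antidiagonal t,
      Submodule.map₂ (TensorProduct.mk k (QExt q m) (DivPow q⁻¹ n))
        (QExt.deg q m p.1) (DivPow.spanDeg q⁻¹ P p.2) : Submodule k (Omega q m n)) =
      (pairSet m P t).card := by
  rw [iSup_map₂_eq_span]
  exact rank_span_image (LinearIndependent.tmul_of_isDomain (linearIndependent_extMono (q := q))
    (linearIndependent_divPowMono (q := q⁻¹))) (pairSet m P t)

theorem rank_deg (t : ℕ) :
    Module.rank k (Omega.deg q m n t) = (pairSet m (fun _ : Fin n → ℕ => True) t).card := by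
  have h : Omega.deg q m n t = ⨆ p ∈ Finset.HasAntidiagonal.antidiagonal t,
      Submodule.map₂ (TensorProduct.mk k (QExt q m) (DivPow q⁻¹ n))
        (QExt.deg q m p.1) (DivPow.spanDeg q⁻¹ (fun _ => True) p.2) := by
    simp only [Omega.deg, DivPow.deg_eq]
  rw [h, rank_iSup_map₂]

theorem rank_restrictedDeg (t : ℕ) : Module.rank k (Omega.restrictedDeg q m n t) =
    (pairSet m (fun β : Fin n → ℕ => ∀ i, β i ≤ qChar q⁻¹ - 1) t).card := by
  have h : Omega.restrictedDeg q m n t = ⨆ p ∈ Finset.HasAntidiagonal.antidiagonal t,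
      Submodule.map₂ (TensorProduct.mk k (QExt q m) (DivPow q⁻¹ n)) (QExt.deg q m p.1)
        (DivPow.spanDeg q⁻¹ (fun β => ∀ i, β i ≤ qChar q⁻¹ - 1) p.2) := by
    simp only [Omega.restrictedDeg, DivPow.restrictedDeg_eq]
  rw [h, rank_iSup_map₂]

/-! ### Counting -/

/-- The exponents attached to a monomial of `Ω_q^!(m|n)`. -/
def pairExp (x : Finset (Fin m) × (Fin n → ℕ)) : Fin (m + n) → ℤ :=
  Fin.append (fun i => if i ∈ x.1 then 1 else 0) (fun j => (x.2 j : ℤ))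

theorem pairExp_injective : Function.Injective (pairExp (m := m) (n := n)) := by
  intro x y h
  refine Prod.ext (Finset.ext fun i => ?_) (funext fun j => ?_)
  · have := congrFun h (Fin.castAdd n i)
    simp only [pairExp, Fin.append_left] at this
    by_cases h1 : i ∈ x.1 <;> by_cases h2 : i ∈ y.1 <;> simp_all
  · have := congrFun h (Fin.natAdd m j)
    simpa only [pairExp, Fin.append_right, Nat.cast_inj] using this

theorem sum_pairExp (x : Finset (Fin m) × (Fin n → ℕ)) :
    ∑ i, pairExp x i = ((x.1.card + ∑ j, x.2 j : ℕ) : ℤ) := by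
  simp [Fin.sum_univ_add, pairExp]

theorem pairExp_mem_wtSet_iff {P : (Fin n → ℕ) → Prop}
    (hP : ∀ β : Fin n → ℕ, P β ↔ ∀ j : Fin n, (β j : ℤ) ∈ adm q m (m + j)) (t : ℕ)
    (x : Finset (Fin m) × (Fin n → ℕ)) : pairExp x ∈ wtSet q m n t ↔ x ∈ pairSet m P t := by
  rw [mem_pairSet, hP, wtSet, Set.mem_ofPred_eq, sum_pairExp, Nat.cast_inj, and_comm]
  refine and_congr_right fun _ => ⟨fun h j => ?_, fun h i => ?_⟩
  · simpa only [pairExp, Fin.append_right, Fin.val_natAdd] using h (Fin.natAdd m j)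
  · refine Fin.addCases (fun i => ?_) (fun j => ?_) i
    · rw [mem_adm_of_lt (by simp)]
      simp only [pairExp, Fin.append_left]
      split_ifs <;> omega
    · simpa only [pairExp, Fin.append_right, Fin.val_natAdd] using h j

/-- Monomials of `Ω_q^!` correspond to admissible exponents, an exterior exponent being the
indicator function of a subset. Stating this for a general `P` covers the generic and the restricted
case. -/
theorem ncard_wtSet {P : (Fin n → ℕ) → Prop}
    (hP : ∀ β : Fin n → ℕ, P β ↔ ∀ j : Fin n, (β j : ℤ) ∈ adm q m (m + j)) (t : ℕ) :
    (wtSet q m n t).ncard = (pairSet m P t).card := by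
  rw [← Set.ncard_coe_finset, ← Set.ncard_image_of_injective _ pairExp_injective]
  congr 1
  ext a
  constructor
  · intro h
    have ha : pairExp (m := m) (n := n) (Finset.univ.filter fun i => a (Fin.castAdd n i) = 1,
        fun j => (a (Fin.natAdd m j)).toNat) = a := by
      funext i
      refine Fin.addCases (fun i => ?_) (fun j => ?_) i
      · have := (mem_adm_of_lt i.2).1 (h.1 (Fin.castAdd n i))
        simp only [pairExp, Fin.append_left, Finset.mem_filter_univ]
        split_ifs <;> omega
      · simp only [pairExp, Fin.append_right]
        exact Int.toNat_of_nonneg (nonneg_of_mem_adm (h.1 _))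
    refine ⟨_, ?_, ha⟩
    rwa [SetLike.mem_coe, ← pairExp_mem_wtSet_iff hP, ha]
  · rintro ⟨x, hx, rfl⟩
    exact (pairExp_mem_wtSet_iff hP t x).2 hx

theorem finsuppAntidiag_card (s : ℕ) (p : (Fin n → ℕ) → Prop) [DecidablePred p] :
    ((Finset.finsuppAntidiag Finset.univ s).filter fun l : Fin n →₀ ℕ => p l).card =
      (expSet p s).card := by
  refine Finset.card_bij (fun l _ => ⇑l) (fun l hl => ?_) (fun _ _ _ _ h => DFunLike.coe_injective h)
    fun β hβ => ⟨Finsupp.equivFunOnFinite.symm β, ?_, rfl⟩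
  · rw [Finset.mem_filter, Finset.mem_finsuppAntidiag] at hl
    exact mem_expSet.2 ⟨hl.1.1, hl.2⟩
  · rw [mem_expSet] at hβ
    rw [Finset.mem_filter, Finset.mem_finsuppAntidiag]
    exact ⟨⟨hβ.1, Finset.subset_univ _⟩, hβ.2⟩

/-- Truncated subtraction gives `choose 0 0 = 1` for `n = s = 0`, in agreement with the convention
that `-1` over `0` is `1`. -/
theorem card_expSet_true (n s : ℕ) :
    (expSet (fun _ : Fin n → ℕ => True) s).card = (n + s - 1).choose s := by
  rw [← finsuppAntidiag_card, Finset.filter_true, Finset.card_finsuppAntidiag_nat_eq_choose,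
    Finset.card_univ, Fintype.card_fin]

open PowerSeries in
theorem coeff_geom_sum (ℓ j : ℕ) : coeff j (∑ i ∈ Finset.range ℓ, (X : ℤ⟦X⟧) ^ i) =
    if j < ℓ then 1 else 0 := by
  simp [coeff_X_pow]

open PowerSeries in
theorem card_expSet_lt (n ℓ s : ℕ) : ((expSet (fun β : Fin n → ℕ => ∀ i, β i < ℓ) s).card : ℤ) =
    coeff s ((∑ i ∈ Finset.range ℓ, (X : ℤ⟦X⟧) ^ i) ^ n) := by
  rw [← finsuppAntidiag_card]
  have : (∑ i ∈ Finset.range ℓ, (X : ℤ⟦X⟧) ^ i) ^ n =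
      ∏ _j : Fin n, ∑ i ∈ Finset.range ℓ, (X : ℤ⟦X⟧) ^ i := by simp
  rw [this, coeff_prod, Finset.card_filter]
  push_cast
  refine Finset.sum_congr rfl fun l _ => ?_
  simp only [coeff_geom_sum, Finset.prod_ite_zero, Finset.prod_const_one, Finset.mem_univ,
    true_imp_iff]

open PowerSeries in
-- The generating function is `(1 - X^ℓ)^n` times `(1 - X)^(-n)`; the first factor is expanded by
-- the binomial theorem, and the second has the coefficients `(n - 1 + d).choose (n - 1)`.
theorem card_expSet_lt_eq_sum {n : ℕ} (hn : 0 < n) {ℓ : ℕ} (hℓ : 0 < ℓ) (s : ℕ) :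
    ((expSet (fun β : Fin n → ℕ => ∀ i, β i < ℓ) s).card : ℤ) =
      ∑ i ∈ Finset.range (s / ℓ + 1),
        (-1) ^ i * (n.choose i : ℤ) * ((n + s - i * ℓ - 1).choose (n - 1) : ℤ) := by
  have h1 : (∑ i ∈ Finset.range ℓ, (X : ℤ⟦X⟧) ^ i) ^ n =
      (1 - X ^ ℓ) ^ n * (invOneSubPow ℤ n).val := by
    rw [← geom_sum_mul_neg, mul_pow, mul_assoc, ← invOneSubPow_inv_eq_one_sub_pow,
      (invOneSubPow ℤ n).inv_val, mul_one]
  have h2 : ((1 : ℤ⟦X⟧) - X ^ ℓ) ^ n =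
      ∑ i ∈ Finset.range (n + 1), C ((-1) ^ i * (n.choose i : ℤ)) * X ^ (i * ℓ) := by
    rw [sub_eq_neg_add, add_pow]
    refine Finset.sum_congr rfl fun i _ => ?_
    rw [neg_pow, ← pow_mul, mul_comm ℓ i, one_pow]
    simp only [map_mul, map_pow, map_neg, map_one, map_natCast]
    ring
  rw [card_expSet_lt, h1, h2, Finset.sum_mul, map_sum,
    invOneSubPow_val_eq_mk_sub_one_add_choose_of_pos _ _ hn]
  simp only [mul_assoc, coeff_C_mul, coeff_X_pow_mul', coeff_mk]
  have h3 : ∀ i, i * ℓ ≤ s ↔ i < s / ℓ + 1 := fun i => by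
    rw [Nat.lt_succ_iff, Nat.le_div_iff_mul_le hℓ]
  -- The binomial theorem bounds the index by `n`, the claimed sum by `s / ℓ`. Terms with `i * ℓ >
  -- s` do not contribute to the coefficient, and those with `i > n` vanish since `n.choose i = 0`.
  calc _ = ∑ i ∈ (Finset.range (n + 1)).filter (fun i => i * ℓ ≤ s),
        (-1) ^ i * ((n.choose i : ℤ) * ((n - 1 + (s - i * ℓ)).choose (n - 1) : ℤ)) := by
        rw [Finset.sum_filter]
        refine Finset.sum_congr rfl fun i _ => ?_
        split_ifs <;> simp
    _ = ∑ i ∈ (Finset.range (s / ℓ + 1)).filter (fun i => i < n + 1),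
        (-1) ^ i * ((n.choose i : ℤ) * ((n - 1 + (s - i * ℓ)).choose (n - 1) : ℤ)) := by
        refine Finset.sum_congr (Finset.ext fun i => ?_) fun _ _ => rfl
        simp only [Finset.mem_filter, Finset.mem_range, h3, and_comm]
    _ = _ := by
        rw [Finset.sum_filter]
        refine Finset.sum_congr rfl fun i hi => ?_
        rw [Finset.mem_range, ← h3] at hi
        split_ifs with h
        · rw [show n - 1 + (s - i * ℓ) = n + s - i * ℓ - 1 by omega]
        · rw [Nat.choose_eq_zero_of_lt (by omega)]; simp

/-! ### The highest exponents -/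

/-- `E_j` is blocked when there is nothing to lower at `hi j`, or when `lo j` is already full. -/
theorem isHighest_of {t : ℤ} {a : Fin (m + n) → ℤ} (ha : ∀ i : Fin (m + n), a i ∈ adm q m i)
    (hsum : ∑ i, a i = t)
    (h : ∀ j : Fin (m + n - 1), a (hi j) = 0 ∨ a (lo j) + 1 ∉ adm q m (lo j)) :
    IsHighest q m n t a := by
  refine ⟨⟨ha, hsum⟩, fun j hj => ?_⟩
  rcases h j with h | h
  · have := nonneg_of_mem_adm (hj.1 (hi j))
    simp [h] at this
  · exact h (by simpa using hj.1 (lo j))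

theorem omega_apply (t : ℕ) (i : Fin (m + n)) : omega m n t i = if i.1 < t then 1 else 0 := by
  simp [omega, eps]

theorem sum_eps {a : ℕ} (ha : a < m + n) : ∑ i, eps m n a i = 1 := by
  rw [Finset.sum_eq_single ⟨a, ha⟩]
  · simp [eps]
  · intro b _ hb
    exact if_neg fun h => hb (Fin.ext h)
  · simp

theorem sum_omega {t : ℕ} (ht : t ≤ m + n) : ∑ i, omega m n t i = t := by
  simp only [omega, Finset.sum_apply]
  rw [Finset.sum_comm, Finset.sum_congr rfl fun a ha => sum_eps (m := m) (n := n)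
    ((Finset.mem_range.1 ha).trans_le ht)]
  simp

theorem two_notMem_adm {i : ℕ} (hi : i < m) : (1 + 1 : ℤ) ∉ adm q m i := by
  rw [mem_adm_of_lt hi]; omega

theorem isHighest_omega {t : ℕ} (ht : t ≤ m) : IsHighest q m n t (omega m n t) := by
  refine isHighest_of (fun i => ?_) (sum_omega (by omega)) fun j => ?_
  · rw [omega_apply]
    split_ifs with h
    · rw [mem_adm_of_lt (by omega)]; omega
    · exact zero_mem_adm _ _ _
  · rw [omega_apply, omega_apply]
    by_cases h : (hi j).1 < t
    · have h1 : (lo j).1 < t := lt_of_le_of_lt (Nat.le_succ _) h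
      rw [if_pos h1]
      exact .inr (two_notMem_adm (by omega))
    · exact .inl (if_neg h)

theorem isHighest_omega_add (hq0 : q ≠ 0) (hq1 : q ^ 2 ≠ 1) (hq : qChar q = 0) (hn : 0 < n) {t : ℕ}
    (ht : m < t) : IsHighest q m n t (omega m n m + ((t : ℤ) - m) • eps m n m) := by
  have happ : ∀ i : Fin (m + n), (omega m n m + ((t : ℤ) - m) • eps m n m) i =
      if i.1 < m then 1 else if i.1 = m then (t : ℤ) - m else 0 := by
    intro i
    rw [Pi.add_apply, Pi.smul_apply, omega_apply, eps, smul_eq_mul]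
    split_ifs <;> omega
  refine isHighest_of (fun i => ?_) ?_ fun j => ?_
  · rw [happ]
    split_ifs with h h
    · rw [mem_adm_of_lt h]; omega
    · rw [mem_adm_generic hq0 hq1 hq (by omega)]; omega
    · exact zero_mem_adm _ _ _
  · simp only [Pi.add_apply, Pi.smul_apply, Finset.sum_add_distrib, ← Finset.smul_sum]
    rw [sum_omega (by omega), sum_eps (by omega)]
    simp
  · rw [happ, happ]
    have h2 : (hi j).1 = (lo j).1 + 1 := rfl
    by_cases h : (lo j).1 < m
    · rw [if_pos h]
      exact .inr (two_notMem_adm h)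
    · rw [if_neg (by omega), if_neg (by omega)]
      exact .inl rfl

theorem stairWt_apply (ℓ i r : ℕ) (x : Fin (m + n)) : stairWt m n ℓ i r x =
    if x.1 < m then 1 else if x.1 < m + (i - 1) then (ℓ : ℤ) - 1 else
      if x.1 = m + (i - 1) then (r : ℤ) else 0 := by
  have h1 : ∑ a ∈ Finset.range (i - 1), ((ℓ : ℤ) - 1) * (if x.1 = m + a then 1 else 0) =
      if m ≤ x.1 ∧ x.1 < m + (i - 1) then (ℓ : ℤ) - 1 else 0 := by
    rw [← Finset.mul_sum]
    have : ∑ a ∈ Finset.range (i - 1), (if x.1 = m + a then (1 : ℤ) else 0) =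
        if m ≤ x.1 ∧ x.1 < m + (i - 1) then 1 else 0 := by
      split_ifs with h
      · rw [Finset.sum_eq_single (x.1 - m)]
        · rw [if_pos (by omega)]
        · intro b _ hb
          rw [if_neg (by omega)]
        · intro hb
          exact absurd (Finset.mem_range.2 (by omega)) hb
      · refine Finset.sum_eq_zero fun a ha => if_neg ?_
        have := Finset.mem_range.1 ha
        omega
    rw [this, mul_ite, mul_one, mul_zero]
  simp only [stairWt, Pi.add_apply, Pi.smul_apply, Finset.sum_apply, omega_apply, eps, smul_eq_mul]
  rw [h1]
  split_ifs <;> omega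

/-- The variables are filled greedily from the left: all those before `m + i` (counted from `1`) are
full, and all those after it are empty. -/
theorem isHighest_stairWt (hq0 : q ≠ 0) (hq1 : q ^ 2 ≠ 1) (hq : qChar q ≠ 0) {t i r : ℕ}
    (ht : m < t) (hi1 : 1 ≤ i) (hin : i ≤ n) (hr : r ≤ qChar q - 1)
    (h : t - m = (i - 1) * (qChar q - 1) + r) :
    IsHighest q m n t (stairWt m n (qChar q) i r) := by
  refine isHighest_of (fun x => ?_) ?_ fun j => ?_
  · rw [stairWt_apply]
    split_ifs with h1 h2 h3
    · rw [mem_adm_of_lt h1]; omega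
    · rw [mem_adm_restricted hq0 hq1 hq (by omega)]; omega
    · rw [mem_adm_restricted hq0 hq1 hq (by omega)]; omega
    · exact zero_mem_adm _ _ _
  · simp only [stairWt, Pi.add_apply, Pi.smul_apply, Finset.sum_apply, Finset.sum_add_distrib,
      ← Finset.smul_sum]
    rw [sum_omega (by omega), sum_eps (by omega), Finset.sum_comm]
    rw [Finset.sum_congr rfl fun a ha => sum_eps (m := m) (n := n) (a := m + a)
      (by have := Finset.mem_range.1 ha; omega)]
    have h1 : (t : ℤ) = m + ((i - 1 : ℕ) * ((qChar q : ℤ) - 1) + r) := by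
      rw [← Nat.cast_one (R := ℤ), ← Nat.cast_sub (Nat.one_le_iff_ne_zero.2 hq)]
      exact_mod_cast (by omega : t = m + ((i - 1) * (qChar q - 1) + r))
    rw [h1]
    simp
    ring
  · rw [stairWt_apply, stairWt_apply]
    have h2 : (hi j).1 = (lo j).1 + 1 := rfl
    by_cases h3 : (lo j).1 < m
    · rw [if_pos h3]
      exact .inr (two_notMem_adm h3)
    by_cases h4 : (lo j).1 < m + (i - 1)
    · rw [if_neg h3, if_pos h4, mem_adm_restricted hq0 hq1 hq (by omega)]
      exact .inr (by omega)
    · rw [if_neg (by omega), if_neg (by omega), if_neg (by omega)]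
      exact .inl rfl

/-! ### Dimensions -/

theorem card_pairSet_of_lt (P : (Fin n → ℕ) → Prop) {t : ℕ} (ht : m < t) :
    (pairSet m P t).card = ∑ s ∈ Finset.range (m + 1), m.choose s * (expSet P (t - s)).card := by
  rw [card_pairSet]
  refine (Finset.sum_subset (Finset.range_mono (by omega)) fun s _ hs => ?_).symm
  rw [Finset.mem_range] at hs
  rw [Nat.choose_eq_zero_of_lt (by omega), zero_mul]

theorem card_expSet_true_sub {s t : ℕ} (hs : s ≤ t) :
    (expSet (fun _ : Fin n → ℕ => True) (t - s)).card = (n + t - s - 1).choose (t - s) := by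
  rw [card_expSet_true, show n + (t - s) - 1 = n + t - s - 1 by omega]

theorem generic_iff (hq0 : q ≠ 0) (hq1 : q ^ 2 ≠ 1) (hq : qChar q = 0) (β : Fin n → ℕ) :
    True ↔ ∀ j : Fin n, (β j : ℤ) ∈ adm q m (m + j) :=
  (iff_true_intro fun _ => (mem_adm_generic hq0 hq1 hq (by omega)).2 (by omega)).symm

theorem restricted_iff (hq0 : q ≠ 0) (hq1 : q ^ 2 ≠ 1) (hq : qChar q ≠ 0) (β : Fin n → ℕ) :
    (∀ i, β i ≤ qChar q⁻¹ - 1) ↔ ∀ j : Fin n, (β j : ℤ) ∈ adm q m (m + j) := by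
  refine forall_congr' fun j => ?_
  rw [mem_adm_restricted hq0 hq1 hq (by omega), qChar_inv]
  omega

theorem adm_lt_qChar (hq0 : q ≠ 0) (hq1 : q ^ 2 ≠ 1) (hq : 3 ≤ qChar q) (i : ℕ) (x : ℤ)
    (hx : x ∈ adm q m i) : x < qChar q := by
  by_cases hi : i < m
  · rw [mem_adm_of_lt hi] at hx; omega
  · exact ((mem_adm_restricted hq0 hq1 (by omega) (not_lt.1 hi)).1 hx).2

end QuantumGrassmann
end

/-! ### Dimensions and simple modules in the generic and the restricted case. -/

theorem corollary34 {k : Type*} [Field k] [IsAlgClosed k] [CharZero k] (m n : ℕ) (q : k)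
    (hq0 : q ≠ 0) (hq1 : q ^ 2 ≠ 1) :
    -- the generic case
    (QuantumGrassmann.qChar q = 0 → ∀ t : ℕ,
      (t ≤ m →
        ∀ d : ℕ, d = ∑ s ∈ Finset.range (t + 1), m.choose s * (n + t - s - 1).choose (t - s) →
        Module.rank k (QuantumGrassmann.Omega.deg q m n t) = d ∧
        QuantumGrassmann.SimpleOfDim k (QuantumGrassmann.UGl q m n)
          (QuantumGrassmann.VGl q (QuantumGrassmann.omega m n t)) d ∧
        QuantumGrassmann.SimpleOfDim k (QuantumGrassmann.USl q m n)
          (QuantumGrassmann.VSl q (QuantumGrassmann.omega m n t)) d) ∧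
      (m < t →
        ∀ d : ℕ, d = ∑ s ∈ Finset.range (m + 1), m.choose s * (n + t - s - 1).choose (t - s) →
        Module.rank k (QuantumGrassmann.Omega.deg q m n t) = d ∧
        (0 < n →
          QuantumGrassmann.SimpleOfDim k (QuantumGrassmann.UGl q m n)
            (QuantumGrassmann.VGl q (QuantumGrassmann.omega m n m +
              ((t : ℤ) - m) • QuantumGrassmann.eps m n m)) d ∧
          QuantumGrassmann.SimpleOfDim k (QuantumGrassmann.USl q m n)
            (QuantumGrassmann.VSl q (QuantumGrassmann.omega m n m +
              ((t : ℤ) - m) • QuantumGrassmann.eps m n m)) d))) ∧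
    -- the restricted case
    (∀ ℓ : ℕ, QuantumGrassmann.qChar q = ℓ → 3 ≤ ℓ →
      (∀ t : ℕ,
        (t ≤ m →
          ∀ d : ℕ, d = ∑ s ∈ Finset.range (t + 1), m.choose s *
            Module.finrank k (QuantumGrassmann.DivPow.restrictedDeg q⁻¹ n (t - s)) →
          Module.rank k (QuantumGrassmann.Omega.restrictedDeg q m n t) = d ∧
          QuantumGrassmann.SimpleOfDim k (QuantumGrassmann.uGl q m n)
            (QuantumGrassmann.vGl q (QuantumGrassmann.omega m n t)) d ∧
          QuantumGrassmann.SimpleOfDim k (QuantumGrassmann.uSl q m n)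
            (QuantumGrassmann.vSl q (QuantumGrassmann.omega m n t)) d) ∧
        (m < t →
          ∀ d : ℕ, d = ∑ s ∈ Finset.range (m + 1), m.choose s *
            Module.finrank k (QuantumGrassmann.DivPow.restrictedDeg q⁻¹ n (t - s)) →
          Module.rank k (QuantumGrassmann.Omega.restrictedDeg q m n t) = d ∧
          ∀ i r : ℕ, 1 ≤ i → i ≤ n → r ≤ ℓ - 1 → t - m = (i - 1) * (ℓ - 1) + r →
            QuantumGrassmann.SimpleOfDim k (QuantumGrassmann.uGl q m n)
              (QuantumGrassmann.vGl q (QuantumGrassmann.stairWt m n ℓ i r)) d ∧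
            QuantumGrassmann.SimpleOfDim k (QuantumGrassmann.uSl q m n)
              (QuantumGrassmann.vSl q (QuantumGrassmann.stairWt m n ℓ i r)) d)) ∧
      (∀ s : ℕ,
        Module.Finite k (QuantumGrassmann.DivPow.restrictedDeg q⁻¹ n s) ∧
        (0 < n →
          (Module.finrank k (QuantumGrassmann.DivPow.restrictedDeg q⁻¹ n s) : ℤ) =
            ∑ i ∈ Finset.range (s / ℓ + 1),
              (-1) ^ i * (n.choose i : ℤ) * ((n + s - i * ℓ - 1).choose (n - 1) : ℤ)))) := by
  open QuantumGrassmann in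
  refine ⟨fun hq t => ?_, ?_⟩
  -- The same set of monomials computes the dimension of the component of `Ω_q^!` and that of the
  -- simple module.
  · have hcard := ncard_wtSet (generic_iff (m := m) (n := n) hq0 hq1 hq) t
    refine ⟨fun ht d hd => ?_, fun ht d hd => ?_⟩
    · have hd' : (pairSet m (fun _ : Fin n → ℕ => True) t).card = d := by
        rw [card_pairSet, hd]
        refine Finset.sum_congr rfl fun s hs => ?_
        rw [card_expSet_true_sub (by have := Finset.mem_range.1 hs; omega)]
      rw [hd'] at hcard
      exact ⟨by rw [rank_deg, hd'], simpleOfDim_VGl hq0 hq1 (isHighest_omega ht) hcard,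
        simpleOfDim_VSl hq0 hq1 (isHighest_omega ht) hcard⟩
    · have hd' : (pairSet m (fun _ : Fin n → ℕ => True) t).card = d := by
        rw [card_pairSet_of_lt _ ht, hd]
        refine Finset.sum_congr rfl fun s hs => ?_
        rw [card_expSet_true_sub (by have := Finset.mem_range.1 hs; omega)]
      rw [hd'] at hcard
      exact ⟨by rw [rank_deg, hd'], fun hn =>
        ⟨simpleOfDim_VGl hq0 hq1 (isHighest_omega_add hq0 hq1 hq hn ht) hcard,
          simpleOfDim_VSl hq0 hq1 (isHighest_omega_add hq0 hq1 hq hn ht) hcard⟩⟩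
  · rintro ℓ rfl hℓ
    have hq : qChar q ≠ 0 := by omega
    have hlt := adm_lt_qChar (m := m) hq0 hq1 hℓ
    have hpow := pow_two_mul_qChar hq0 hq1 hq
    refine ⟨fun t => ?_, fun s => ⟨?_, fun hn => ?_⟩⟩
    · have hcard := ncard_wtSet (restricted_iff (m := m) (n := n) hq0 hq1 hq) t
      have hdim : ∀ s, Module.finrank k (DivPow.restrictedDeg q⁻¹ n s) =
          (expSet (fun β : Fin n → ℕ => ∀ i, β i ≤ qChar q⁻¹ - 1) s).card := fun s => by
        rw [DivPow.restrictedDeg_eq, finrank_spanDeg]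
      simp only [hdim]
      refine ⟨fun ht d hd => ?_, fun ht d hd => ?_⟩
      · rw [card_pairSet, ← hd] at hcard
        exact ⟨by rw [rank_restrictedDeg, card_pairSet, ← hd],
          simpleOfDim_vGl hq0 hq1 (isHighest_omega ht) hcard hlt hpow,
          simpleOfDim_vSl hq0 hq1 (isHighest_omega ht) hcard hlt hpow⟩
      · rw [card_pairSet_of_lt _ ht, ← hd] at hcard
        refine ⟨by rw [rank_restrictedDeg, card_pairSet_of_lt _ ht, ← hd],
          fun i r hi1 hin hr h => ?_⟩
        have hhw := isHighest_stairWt hq0 hq1 hq ht hi1 hin hr h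
        exact ⟨simpleOfDim_vGl hq0 hq1 hhw hcard hlt hpow,
          simpleOfDim_vSl hq0 hq1 hhw hcard hlt hpow⟩
    · rw [DivPow.restrictedDeg_eq]
      exact finite_spanDeg _ _
    · rw [DivPow.restrictedDeg_eq, finrank_spanDeg, ← card_expSet_lt_eq_sum hn (by omega)]
      congr 3
      funext β
      rw [qChar_inv]
      exact propext (forall_congr' fun i => by omega)
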